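/- Let $k$ be an algebraically closed field, $d\geqslant 1$ an integer, and let $\mathscr T$ be a $k$-linear, $\operatorname{Hom}$-finite $(d+2)$-angulated category (in the sense of Geiss–Keller–Oppermann) with $d$-suspension functor $\Sigma^d$, in which idempotents split. Assume that $\mathscr T$ has a Serre functor, that is, an autoequivalence $S$ with natural $k$-linear isomorphisms $\operatorname{Hom}_k(\mathscr T(X,Y),k)\cong\mathscr T(Y,SX)$. Let $T\in\mathscr T$ be cluster tilting in the sense of Oppermann–Thomas, that is: (1) $\mathscr T(T,\Sigma^d T)=0$, and (2) each $X\in\mathscr T$ occurs in a $(d+2)$-angle $T_d\to T_{d-1}\to\cdots\to T_0\to X\to\Sigma^d T_d$ with $T_i\in\operatorname{add}T$ for $0\leqslant i\leqslant d$. Let $\Gamma=\operatorname{End}_{\mathscr T}T$, and let $\operatorname{mod}\Gamma$ be the category of finite dimensional right $\Gamma$-modules. Assume that $\mathscr T$ has only finitely many indecomposable objects up to isomorphism. Then: (i) $\Gamma$ is weakly $d$-representation finite, that is, there is a $d$-cluster tilting module $M\in\operatorname{mod}\Gamma$. This means that $\mathscr X=\operatorname{add}M$ is functorially finite in $\operatorname{mod}\Gamma$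 and $$\mathscr X=\{X\in\operatorname{mod}\Gamma\mid \operatorname{Ext}^i_\Gamma(X,\mathscr X)=0\text{ for }1\leqslant i\leqslant d-1\}=\{X\in\operatorname{mod}\Gamma\mid \operatorname{Ext}^i_\Gamma(\mathscr X,X)=0\text{ for }1\leqslant i\leqslant d-1\}.$$ (ii) If $\Gamma$ has finite global dimension, then $\Gamma$ is $d$-representation finite, that is, it is weakly $d$-representation finite and its global dimension is at most $d$. -/

import Mathlib

open CategoryTheory CategoryTheory.Limits

universe w v u

namespace HigherCluster

section Angulated

variable {C : Type u} [Category.{v} C] [Preadditive C]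

attribute [local instance] hasBinaryBiproducts_of_finite_biproducts

/-- A `(d+2)`-`Σ`-sequence `X₀ ⟶ X₁ ⟶ ⋯ ⟶ X_{d+1} ⟶ Σ X₀`
(the objects are numbered from `0` to `d+1`, so there are `d+2` of them before `Σ X₀`). -/
structure SuspSeq (sus : C ⥤ C) (d : ℕ) where
  /-- the objects `X₀, …, X_{d+1}` -/
  obj (i : ℕ) (hi : i < d + 2 := by omega) : C
  /-- the morphisms `X_i ⟶ X_{i+1}` -/
  map (i : ℕ) (hi : i + 1 < d + 2 := by omega) : obj i ⟶ obj (i + 1)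
  /-- the last morphism `X_{d+1} ⟶ Σ X₀` -/
  conn : obj (d + 1) ⟶ sus.obj (obj 0)

namespace SuspSeq

variable {sus : C ⥤ C} {d : ℕ}

/-- A morphism of `(d+2)`-`Σ`-sequences: `φ₀, …, φ_{d+1}` such that all squares commute, the last
square being formed with `Σ φ₀`. -/
structure Hom (X Y : SuspSeq sus d) where
  /-- the components -/
  app (i : ℕ) (hi : i < d + 2 := by omega) : X.obj i ⟶ Y.obj i
  comm (i : ℕ) (hi : i + 1 < d + 2) : X.map i ≫ app (i + 1) = app i ≫ Y.map i
  comm_conn : X.conn ≫ sus.map (app 0) = app (d + 1) ≫ Y.conn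

/-- `Z`, with the given inclusions and projections, is a direct sum of `X` and `Y`. -/
structure DirectSumData (X Y Z : SuspSeq sus d) where
  /-- first inclusion -/
  inl : Hom X Z
  /-- second inclusion -/
  inr : Hom Y Z
  /-- first projection -/
  fst : Hom Z X
  /-- second projection -/
  snd : Hom Z Y
  inl_fst (i : ℕ) (hi : i < d + 2) : inl.app i ≫ fst.app i = 𝟙 _
  inr_snd (i : ℕ) (hi : i < d + 2) : inr.app i ≫ snd.app i = 𝟙 _
  total (i : ℕ) (hi : i < d + 2) :
    fst.app i hi ≫ inl.app i hi + snd.app i hi ≫ inr.app i hi = 𝟙 _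

/-- `R` is (isomorphic to) the left rotation
`X₁ ⟶ ⋯ ⟶ X_{d+1} ⟶ Σ X₀ ⟶ Σ X₁` of `X`, whose last morphism is `(-1)^(d+2) Σ α₀`. -/
structure RotationData (X R : SuspSeq sus d) where
  /-- the identification of the first `d+1` objects -/
  iso (i : ℕ) (hi : i + 1 < d + 2 := by omega) : R.obj i ≅ X.obj (i + 1)
  /-- the identification of the last object -/
  isoLast : R.obj (d + 1) ≅ sus.obj (X.obj 0)
  comm (i : ℕ) (hi : i + 2 < d + 2) :
    R.map i ≫ (iso (i + 1)).hom = (iso i).hom ≫ X.map (i + 1)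
  comm_last : R.map d ≫ isoLast.hom = (iso d).hom ≫ X.conn
  comm_conn : R.conn ≫ sus.map (iso 0).hom =
    isoLast.hom ≫ ((-1 : ℤ) ^ (d + 2) • sus.map (X.map 0))

/-- `Z` is (isomorphic to) the cone of `φ : X ⟶ Y`, that is, the sequence
`X₁ ⊞ Y₀ ⟶ X₂ ⊞ Y₁ ⟶ ⋯ ⟶ Σ X₀ ⊞ Y_{d+1} ⟶ Σ X₁ ⊞ Σ Y₀`
with the matrices `(-α_{i+1}, 0; φ_{i+1}, β_i)`. -/
structure ConeData [HasFiniteBiproducts C] {X Y : SuspSeq sus d} (φ : Hom X Y)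
    (Z : SuspSeq sus d) where
  /-- the identification of the first `d+1` objects -/
  iso (i : ℕ) (hi : i + 1 < d + 2 := by omega) : Z.obj i ≅ X.obj (i + 1) ⊞ Y.obj i
  /-- the identification of the last object -/
  isoLast : Z.obj (d + 1) ≅ sus.obj (X.obj 0) ⊞ Y.obj (d + 1)
  comm (i : ℕ) (hi : i + 2 < d + 2) :
    Z.map i ≫ (iso (i + 1)).hom = (iso i).hom ≫
      biprod.desc (biprod.lift (-X.map (i + 1)) (φ.app (i + 1))) (biprod.lift 0 (Y.map i))
  comm_last : Z.map d ≫ isoLast.hom = (iso d).hom ≫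
      biprod.desc (biprod.lift (-X.conn) (φ.app (d + 1))) (biprod.lift 0 (Y.map d))
  comm_conn : Z.conn ≫ sus.map (iso 0).hom ≫
        biprod.lift (sus.map biprod.fst) (sus.map biprod.snd) = isoLast.hom ≫
      biprod.desc (biprod.lift (-sus.map (X.map 0)) (sus.map (φ.app 0))) (biprod.lift 0 Y.conn)

end SuspSeq

/-- A `(d+2)`-angulation (Geiss–Keller–Oppermann) of the additive category `C` with
`d`-suspension `sus` (to be used for an autoequivalence `sus`): a class of `(d+2)`-`Σ`-sequences,
the `(d+2)`-angles, subject to the axioms (F1)–(F4).  Closure under direct sums and direct summands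
together with the trivial sequence on the zero object gives closure under isomorphisms. -/
structure Angulation [HasFiniteBiproducts C] (sus : C ⥤ C) (d : ℕ) where
  /-- the class of `(d+2)`-angles -/
  IsAngle : SuspSeq sus d → Prop
  /-- (F1)(a), direct sums -/
  directSum {X Y Z : SuspSeq sus d} (s : X.DirectSumData Y Z) :
    IsAngle X → IsAngle Y → IsAngle Z
  /-- (F1)(a), direct summands -/
  summand {X Y Z : SuspSeq sus d} (s : X.DirectSumData Y Z) : IsAngle Z → IsAngle X
  /-- (F1)(b): the trivial sequences `X ≅ X ⟶ 0 ⟶ ⋯ ⟶ 0 ⟶ Σ X` are angles -/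
  trivial (X : SuspSeq sus d) (h₀ : IsIso (X.map 0))
    (h : ∀ (i : ℕ) (hi : i < d + 2), 2 ≤ i → IsZero (X.obj i)) : IsAngle X
  /-- (F1)(c): each morphism is the first morphism of an angle -/
  complete {A B : C} (f : A ⟶ B) : ∃ X : SuspSeq sus d, IsAngle X ∧
    ∃ (e₀ : X.obj 0 ≅ A) (e₁ : X.obj 1 ≅ B), X.map 0 ≫ e₁.hom = e₀.hom ≫ f
  /-- (F2): a sequence is an angle if and only if its left rotation is one -/
  rotate {X R : SuspSeq sus d} (r : X.RotationData R) : IsAngle X ↔ IsAngle R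
  /-- (F3): a commutative square extends to a morphism of angles -/
  extend {X Y : SuspSeq sus d} (hX : IsAngle X) (hY : IsAngle Y)
    (f₀ : X.obj 0 ⟶ Y.obj 0) (f₁ : X.obj 1 ⟶ Y.obj 1) (h : X.map 0 ≫ f₁ = f₀ ≫ Y.map 0) :
    ∃ φ : X.Hom Y, φ.app 0 = f₀ ∧ φ.app 1 = f₁
  /-- (F4): the extension can be chosen such that its cone is an angle -/
  extend_cone {X Y : SuspSeq sus d} (hX : IsAngle X) (hY : IsAngle Y)
    (f₀ : X.obj 0 ⟶ Y.obj 0) (f₁ : X.obj 1 ⟶ Y.obj 1) (h : X.map 0 ≫ f₁ = f₀ ≫ Y.map 0) :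
    ∃ φ : X.Hom Y, φ.app 0 = f₀ ∧ φ.app 1 = f₁ ∧
      ∃ Z : SuspSeq sus d, IsAngle Z ∧ Nonempty (SuspSeq.ConeData φ Z)

end Angulated

section Add

variable {C : Type u} [Category.{v} C] [Preadditive C] [HasFiniteBiproducts C]

attribute [local instance] hasBinaryBiproducts_of_finite_biproducts

/-- `add M`: the objects which are direct summands of finite direct sums of copies of `M`
(in an idempotent complete category, a retract is the same as a direct summand). -/
def add (M : C) : ObjectProperty C := fun X =>
  ∃ n : ℕ, Nonempty (Retract X (⨁ fun _ : Fin n => M))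

/-- `C` has only finitely many indecomposable objects up to isomorphism. -/
def HasFinitelyManyIndecomposables (C : Type u) [Category.{v} C] [Preadditive C]
    [HasFiniteBiproducts C] : Prop :=
  ∃ s : Set C, s.Finite ∧ ∀ X : C, Indecomposable X → ∃ Y ∈ s, Nonempty (X ≅ Y)

/-- `T` is cluster tilting in the sense of Oppermann–Thomas: `Hom(T, Σ^d T) = 0`, and each `X`
occurs in an angle `T_d ⟶ ⋯ ⟶ T₀ ⟶ X ⟶ Σ^d T_d` with all `T_i` in `add T`
(here `T_{d-i}` is the object of the angle with index `i`). -/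
def IsOTClusterTilting {sus : C ⥤ C} {d : ℕ} (𝒜 : Angulation sus d) (T : C) : Prop :=
  (∀ f : T ⟶ sus.obj T, f = 0) ∧
  ∀ X : C, ∃ A : SuspSeq sus d, 𝒜.IsAngle A ∧
    (∀ (i : ℕ) (hi : i < d + 1), add T (A.obj i)) ∧ Nonempty (A.obj (d + 1) ≅ X)

end Add

/-- A Serre functor on a `k`-linear category: an autoequivalence `S` together with `k`-linear
isomorphisms `D Hom(X, Y) ≅ Hom(Y, S X)`, natural in `X` and `Y`, where `D = Hom_k(-, k)`. -/
structure SerreFunctor (k : Type w) [Field k] (C : Type u) [Category.{v} C] [Preadditive C]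
    [Linear k C] where
  /-- the functor -/
  S : C ⥤ C
  isEquivalence : S.IsEquivalence
  /-- the duality isomorphisms -/
  iso (X Y : C) : Module.Dual k (X ⟶ Y) ≃ₗ[k] (Y ⟶ S.obj X)
  naturality_left {X X' : C} (f : X ⟶ X') (Y : C) (φ : Module.Dual k (X ⟶ Y)) :
    iso X' Y (φ.comp (Linear.leftComp k Y f)) = iso X Y φ ≫ S.map f
  naturality_right (X : C) {Y Y' : C} (g : Y' ⟶ Y) (φ : Module.Dual k (X ⟶ Y)) :
    iso X Y' (φ.comp (Linear.rightComp k X g)) = g ≫ iso X Y φ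

section Modules

/-! Right modules over `A` are modules over `Aᵐᵒᵖ`. -/

variable (A : Type v) [Ring A]

/-- `mod A`: the finitely generated right `A`-modules.  For a finite dimensional algebra `A` these
are the finite dimensional right `A`-modules. -/
def fgRightModules : ObjectProperty (ModuleCat.{v} Aᵐᵒᵖ) := fun M => Module.Finite Aᵐᵒᵖ M

variable {A}

/-- `𝒳 ⊆ mod A` is weakly `d`-cluster tilting. -/
def IsWeaklyClusterTilting (d : ℕ) (𝒳 : ObjectProperty (ModuleCat.{v} Aᵐᵒᵖ)) : Prop :=
  (∀ M, 𝒳 M ↔ fgRightModules A M ∧ ∀ N, 𝒳 N → ∀ i : ℕ, 1 ≤ i → i ≤ d - 1 →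
    Subsingleton (Abelian.Ext.{v} M N i)) ∧
  (∀ M, 𝒳 M ↔ fgRightModules A M ∧ ∀ N, 𝒳 N → ∀ i : ℕ, 1 ≤ i → i ≤ d - 1 →
    Subsingleton (Abelian.Ext.{v} N M i))

/-- `𝒳` is functorially finite in `mod A`: each module in `mod A` has a right and a left
`𝒳`-approximation. -/
def IsFunctoriallyFinite (𝒳 : ObjectProperty (ModuleCat.{v} Aᵐᵒᵖ)) : Prop :=
  ∀ M, fgRightModules A M →
    (∃ (X : ModuleCat.{v} Aᵐᵒᵖ) (p : X ⟶ M), 𝒳 X ∧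
      ∀ (X' : ModuleCat.{v} Aᵐᵒᵖ) (f : X' ⟶ M), 𝒳 X' → ∃ g : X' ⟶ X, g ≫ p = f) ∧
    (∃ (X : ModuleCat.{v} Aᵐᵒᵖ) (j : M ⟶ X), 𝒳 X ∧
      ∀ (X' : ModuleCat.{v} Aᵐᵒᵖ) (f : M ⟶ X'), 𝒳 X' → ∃ g : X ⟶ X', j ≫ g = f)

/-- `𝒳` is a `d`-cluster tilting subcategory of `mod A`. -/
def IsClusterTiltingSubcategory (d : ℕ) (𝒳 : ObjectProperty (ModuleCat.{v} Aᵐᵒᵖ)) : Prop :=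
  IsWeaklyClusterTilting d 𝒳 ∧ IsFunctoriallyFinite 𝒳

variable (A)

/-- `A` is weakly `d`-representation finite: there is a module `M` in `mod A` which is `d`-cluster
tilting, that is, `add M` is a `d`-cluster tilting subcategory of `mod A`. -/
def IsWeaklyRepFinite (d : ℕ) : Prop :=
  ∃ M : ModuleCat.{v} Aᵐᵒᵖ, fgRightModules A M ∧ IsClusterTiltingSubcategory d (add M)

/-- The (right) global dimension of `A` is at most `n`. -/
def GlobalDimensionLE (n : ℕ) : Prop :=
  ∀ M : ModuleCat.{v} Aᵐᵒᵖ, HasProjectiveDimensionLE M n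

/-- `A` is `d`-representation finite: weakly `d`-representation finite and of global dimension at
most `d`. -/
def IsRepFinite (d : ℕ) : Prop :=
  IsWeaklyRepFinite A d ∧ GlobalDimensionLE A d

end Modules

end HigherCluster

/-! Write `H = Hom(T, -)`, a functor from the category to right modules over `Γ = End T`, and `Σ`
for `sus`. The essential image of `H` is shown to be the `d`-cluster tilting subcategory.

Every `X` ends an angle with terms in `add T`. Since `Hom(T, ΣT) = 0`, `H` turns it into an exact
sequence `H T_d → ⋯ → H T_0 → H X → 0` with projective terms `H T_i`. Comparing this with `Hom(-,
Y)` of the angle shows that `H` is full (`exists_postcomp_eq`) and that `Ext^i(H X, H Y) = 0` for `1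
≤ i ≤ d - 1` (`subsingleton_ext_range`).

For maximality, a projective presentation of a finitely generated `N` comes from a map in `add T`.
Completing it to an angle gives a coresolution of `N` of length `d - 1` by objects `H X`
(`exists_left_approximation`). Dually, `N` is copresented by sums of `H (S T) ≅ D Γ`; Serre duality
gives `Hom(ΣT, S T) = 0`, and the desuspended angle yields a resolution of length `d - 1`
(`exists_right_approximation`). Their ends are the approximations. If the relevant Ext groups
vanish, `N` splits off such an end, and the image of `H` is closed under retracts because
idempotents lift along `H` and split (`essImage_of_retract`). Finitely many indecomposables give an
additive generator, whose image under `H` generates the subcategory.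

For (ii), `Hom(ΣT, S T) = 0` also makes `H T_d → H T_{d-1}` injective for `X = S T`, so sums of
copies of `D Γ` have projective dimension at most `d`. Every module embeds in such a sum, so a
finite bound on the global dimension above `d` can be lowered by one until it reaches `d`. -/

open scoped ZeroObject

namespace HigherCluster

/-! ### Trivial sequences and rotations. -/

section Sequences

variable {C : Type u} [Category.{v} C] [Preadditive C] [HasFiniteBiproducts C]
  {sus : C ⥤ C} {d : ℕ}

/-- The objects of the sequence `Y ⟶ Y ⟶ 0 ⟶ ⋯ ⟶ 0`. -/
noncomputable def trivialObj (Y : C) : ℕ → C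
  | 0 => Y
  | 1 => Y
  | _ + 2 => 0

/-- The morphisms of the sequence `Y ⟶ Y ⟶ 0 ⟶ ⋯ ⟶ 0`. -/
noncomputable def trivialMap (Y : C) :
    ∀ i : ℕ, trivialObj Y i ⟶ trivialObj Y (i + 1)
  | 0 => 𝟙 Y
  | _ + 1 => 0

lemma isZero_trivialObj (Y : C) (i : ℕ) (hi : 2 ≤ i) :
    IsZero (trivialObj Y i) := by
  obtain ⟨i, rfl⟩ := Nat.exists_eq_add_of_le' hi
  exact isZero_zero C

/-- The trivial sequence `Y ⟶ Y ⟶ 0 ⟶ ⋯ ⟶ 0 ⟶ Σ Y`. -/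
noncomputable def trivialSeq (sus : C ⥤ C) (d : ℕ) (Y : C) : SuspSeq sus d where
  obj i _ := trivialObj Y i
  map i _ := trivialMap Y i
  conn := 0

/-- The objects of the sequence `0 ⟶ Y ⟶ Y ⟶ 0 ⟶ ⋯ ⟶ 0`. -/
noncomputable def shiftedTrivialObj (Y : C) : ℕ → C
  | 0 => 0
  | i + 1 => trivialObj Y i

/-- The morphisms of the sequence `0 ⟶ Y ⟶ Y ⟶ 0 ⟶ ⋯ ⟶ 0`. -/
noncomputable def shiftedTrivialMap (Y : C) :
    ∀ i : ℕ, shiftedTrivialObj Y i ⟶ shiftedTrivialObj Y (i + 1)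
  | 0 => 0
  | i + 1 => trivialMap Y i

/-- The sequence `0 ⟶ Y ⟶ Y ⟶ 0 ⟶ ⋯ ⟶ 0 ⟶ Σ 0`. -/
noncomputable def shiftedTrivialSeq (sus : C ⥤ C) (d : ℕ) (Y : C) :
    SuspSeq sus d where
  obj i _ := shiftedTrivialObj Y i
  map i _ := shiftedTrivialMap Y i
  conn := 0

omit [HasFiniteBiproducts C] in
lemma SuspSeq.exists_rotationData (X : SuspSeq sus d) :
    ∃ R : SuspSeq sus d, Nonempty (X.RotationData R) := by
  let o : ∀ i : ℕ, i < d + 2 → C := fun i _ =>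
    if h : i + 1 < d + 2 then X.obj (i + 1) h else sus.obj (X.obj 0)
  let e : ∀ (i : ℕ) (h : i + 1 < d + 2), o i (by omega) ≅ X.obj (i + 1) h := fun i h =>
    eqToIso (dif_pos h)
  let eL : ∀ (i : ℕ) (hi : i < d + 2) (_ : ¬ i + 1 < d + 2), o i hi ≅ sus.obj (X.obj 0) :=
    fun i _ h => eqToIso (dif_neg h)
  -- When index `i + 2` is out of range, `i = d`; `c` is `X.conn` transported along this equality.
  let c : ∀ (i : ℕ) (hi : i + 1 < d + 2) (_ : i = d), X.obj (i + 1) hi ⟶ sus.obj (X.obj 0) :=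
    fun i hi h => eqToHom (by subst h; rfl) ≫ X.conn
  refine ⟨⟨o, fun i hi => (e i hi).hom ≫ (if h : i + 1 + 1 < d + 2 then
    X.map (i + 1) h ≫ (e (i + 1) h).inv else c i hi (by omega) ≫ (eL (i + 1) hi h).inv),
    (eL (d + 1) (by omega) (by omega)).hom ≫ ((-1 : ℤ) ^ (d + 2) • sus.map (X.map 0)) ≫
      sus.map (e 0 (by omega)).inv⟩, ⟨⟨e, eL (d + 1) (by omega) (by omega), ?_, ?_, ?_⟩⟩⟩
  · intro i hi
    dsimp only
    rw [dif_pos hi]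
    simp
  · dsimp only
    rw [dif_neg (by omega)]
    simp [c]
  · dsimp only
    simp only [Category.assoc, ← sus.map_comp, Iso.inv_hom_id]
    simp

end Sequences

/-! ### Exactness of the Hom sequences of an angle, in both variables. -/

namespace Angulation

variable {C : Type u} [Category.{v} C] [Preadditive C] [HasFiniteBiproducts C]
  {sus : C ⥤ C} {d : ℕ} (𝒜 : Angulation sus d)

lemma isAngle_trivialSeq (Y : C) : 𝒜.IsAngle (trivialSeq sus d Y) :=
  𝒜.trivial _ (inferInstanceAs (IsIso (𝟙 Y))) fun i _ hi => isZero_trivialObj Y i hi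

/-- Its left rotation is the trivial angle on `Y`, because `Σ 0 = 0`; (F2) is then used backwards.
-/
lemma isAngle_shiftedTrivialSeq [sus.IsEquivalence] (hd : 1 ≤ d) (Y : C) :
    𝒜.IsAngle (shiftedTrivialSeq sus d Y) := by
  have hz : IsZero (sus.obj (0 : C)) := by
    have : sus.PreservesZeroMorphisms := Functor.preservesZeroMorphisms_of_isLeftAdjoint sus
    exact sus.map_isZero (isZero_zero C)
  have hz' : IsZero (trivialObj Y (d + 1)) := isZero_trivialObj _ _ (by omega)
  refine (𝒜.rotate (R := trivialSeq sus d Y)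
    ⟨fun i _ => Iso.refl _, hz'.iso hz, fun i hi => ?_, hz.eq_of_tgt _ _,
      hz'.eq_of_src _ _⟩).2 (𝒜.isAngle_trivialSeq Y)
  exact (Category.comp_id _).trans (Category.id_comp _).symm

include 𝒜 in
lemma rotation {X : SuspSeq sus d} (hX : 𝒜.IsAngle X) :
    ∃ (R : SuspSeq sus d) (_ : X.RotationData R), 𝒜.IsAngle R := by
  obtain ⟨R, ⟨r⟩⟩ := X.exists_rotationData
  exact ⟨R, r, (𝒜.rotate r).1 hX⟩

variable {𝒜} (hd : 1 ≤ d)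

include hd

/-- For `i = 0`, extend `(𝟙, X.map 0)` to a morphism from the trivial angle on `X.obj 0`: its third
component starts at a zero object. Rotation gives the other indices. -/
lemma IsAngle.map_comp_map {X : SuspSeq sus d} (hX : 𝒜.IsAngle X) (i : ℕ) (hi : i + 2 < d + 2) :
    X.map i (by omega) ≫ X.map (i + 1) hi = 0 := by
  induction i generalizing X with
  | zero =>
    obtain ⟨φ, h₀, h₁⟩ := 𝒜.extend (𝒜.isAngle_trivialSeq (X.obj 0)) hX (𝟙 _)
      (X.map 0 (by omega)) rfl
    have h := φ.comm 1 (by omega)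
    have hz : IsZero ((trivialSeq sus d (X.obj 0)).obj (1 + 1) hi) := isZero_trivialObj (X.obj 0) 2 le_rfl
    rw [h₁, hz.eq_of_src (φ.app (1 + 1)) 0, comp_zero] at h
    exact h.symm
  | succ i ih =>
    obtain ⟨R, r, hR⟩ := 𝒜.rotation hX
    have h := ih hR (by omega)
    rw [← cancel_epi (r.iso i (by omega)).hom, ← reassoc_of% r.comm i (by omega),
      ← r.comm (i + 1) hi, reassoc_of% h]
    simp

lemma IsAngle.map_comp_conn {X : SuspSeq sus d} (hX : 𝒜.IsAngle X) :
    X.map d (by omega) ≫ X.conn = 0 := by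
  obtain ⟨d, rfl⟩ := Nat.exists_eq_add_of_le' hd
  obtain ⟨R, r, hR⟩ := 𝒜.rotation hX
  have h := hR.map_comp_map (by omega) d (by omega)
  rw [← cancel_epi (r.iso d (by omega)).hom, ← reassoc_of% r.comm d (by omega),
    ← r.comm_last, reassoc_of% h]
  simp

lemma IsAngle.conn_comp_map {X : SuspSeq sus d} (hX : 𝒜.IsAngle X) :
    X.conn ≫ sus.map (X.map 0) = 0 := by
  obtain ⟨R, r, hR⟩ := 𝒜.rotation hX
  have h := hR.map_comp_conn hd
  have hs : ((-1 : ℤ) ^ (d + 2)) * (-1 : ℤ) ^ (d + 2) = 1 := by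
    rw [← mul_pow]; simp
  have h' : X.conn ≫ ((-1 : ℤ) ^ (d + 2) • sus.map (X.map 0)) = 0 := by
    rw [← cancel_epi (r.iso d (by omega)).hom, ← reassoc_of% r.comm_last, ← r.comm_conn,
      reassoc_of% h]
    simp
  rw [← one_smul ℤ (sus.map (X.map 0)), ← hs, mul_smul, Preadditive.comp_zsmul, h', smul_zero]

/-- The rotated trivial angle `Y ⟶ 0 ⟶ ⋯ ⟶ 0 ⟶ Σ Y` maps to `X` by `(f, 0)`, and the last component
of the extension is `g` up to the sign of the rotation. The other weak kernel properties follow by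
rotating. -/
lemma IsAngle.exists_comp_conn_eq {X : SuspSeq sus d} (hX : 𝒜.IsAngle X) {Y : C}
    (f : Y ⟶ X.obj 0) (hf : f ≫ X.map 0 = 0) :
    ∃ g : sus.obj Y ⟶ X.obj (d + 1), g ≫ X.conn = sus.map f := by
  obtain ⟨R, r, hR⟩ := 𝒜.rotation (𝒜.isAngle_trivialSeq Y)
  have hz : IsZero (R.obj 1) :=
    (isZero_trivialObj Y 2 le_rfl).of_iso (r.iso 1 (by omega))
  let e : R.obj 0 ≅ Y := r.iso 0
  let l : R.obj (d + 1) ≅ sus.obj Y := r.isoLast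
  have hl : R.conn ≫ sus.map e.hom = l.hom ≫ ((-1 : ℤ) ^ (d + 2) • sus.map (𝟙 Y)) := r.comm_conn
  obtain ⟨φ, h₀, -⟩ := 𝒜.extend hR hX (e.hom ≫ f) 0
    (by rw [comp_zero, Category.assoc, hf, comp_zero])
  have h := φ.comm_conn
  rw [h₀, sus.map_comp, reassoc_of% hl] at h
  have hs : ((-1 : ℤ) ^ (d + 2)) * (-1 : ℤ) ^ (d + 2) = 1 := by
    rw [← mul_pow]; simp
  refine ⟨((-1 : ℤ) ^ (d + 2)) • (l.inv ≫ φ.app (d + 1)), ?_⟩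
  rw [Preadditive.zsmul_comp, Category.assoc, ← h, Iso.inv_hom_id_assoc, Preadditive.zsmul_comp,
    smul_smul, hs, one_smul, sus.map_id, Category.id_comp]

variable [sus.IsEquivalence]

lemma IsAngle.exists_comp_map_eq {X : SuspSeq sus d} (hX : 𝒜.IsAngle X) (i : ℕ)
    (hi : i + 2 < d + 2) {Y : C} (f : Y ⟶ X.obj (i + 1)) (hf : f ≫ X.map (i + 1) = 0) :
    ∃ g : Y ⟶ X.obj i, g ≫ X.map i = f := by
  induction i generalizing X with
  | zero =>
    obtain ⟨R, r, hR⟩ := 𝒜.rotation hX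
    obtain ⟨ψ, hψ⟩ := hR.exists_comp_conn_eq hd (f ≫ (r.iso 0 (by omega)).inv) (by
      rw [← cancel_mono (r.iso 1 (by omega)).hom, Category.assoc, Category.assoc,
        r.comm 0 (by omega), Iso.inv_hom_id_assoc, hf, zero_comp])
    -- The connecting map of the rotation is `± Σ (X.map 0)`, so full faithfulness of `Σ` brings the
    -- factorization back from `Σ Y` to `Y`.
    obtain ⟨g, hg⟩ := sus.map_surjective (ψ ≫ r.isoLast.hom)
    have : sus.Additive := by
      have := hasBinaryBiproducts_of_finite_biproducts C
      exact Functor.additive_of_preserves_binary_products _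
    refine ⟨((-1 : ℤ) ^ (d + 2)) • g, sus.map_injective ?_⟩
    rw [Preadditive.zsmul_comp, ← Preadditive.comp_zsmul, sus.map_comp, sus.map_zsmul, hg,
      Category.assoc, ← r.comm_conn, reassoc_of% hψ, ← sus.map_comp, Category.assoc,
      Iso.inv_hom_id, Category.comp_id]
  | succ i ih =>
    obtain ⟨R, r, hR⟩ := 𝒜.rotation hX
    obtain ⟨g, hg⟩ := ih hR (by omega) (f ≫ (r.iso (i + 1) (by omega)).inv) (by
      rw [← cancel_mono (r.iso (i + 1 + 1) (by omega)).hom, Category.assoc, Category.assoc,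
        r.comm (i + 1) (by omega), Iso.inv_hom_id_assoc, hf, zero_comp])
    refine ⟨g ≫ (r.iso i (by omega)).hom, ?_⟩
    rw [Category.assoc, ← r.comm i (by omega), reassoc_of% hg]
    simp

lemma IsAngle.exists_comp_map_last_eq {X : SuspSeq sus d} (hX : 𝒜.IsAngle X) {Y : C}
    (f : Y ⟶ X.obj (d + 1)) (hf : f ≫ X.conn = 0) :
    ∃ g : Y ⟶ X.obj d, g ≫ X.map d = f := by
  obtain ⟨d, rfl⟩ := Nat.exists_eq_add_of_le' hd
  obtain ⟨R, r, hR⟩ := 𝒜.rotation hX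
  obtain ⟨g, hg⟩ := hR.exists_comp_map_eq hd d (by omega) (f ≫ (r.iso (d + 1) (by omega)).inv) (by
    rw [← cancel_mono r.isoLast.hom, Category.assoc, Category.assoc,
      r.comm_last, Iso.inv_hom_id_assoc, hf, zero_comp])
  refine ⟨g ≫ (r.iso d (by omega)).hom, ?_⟩
  rw [Category.assoc, ← r.comm d (by omega), reassoc_of% hg]
  simp

/-- Weak cokernels: for `i = 0`, extend `(0, f)` to a morphism into the angle `0 ⟶ Y ⟶ Y ⟶ 0 ⟶ ⋯`
and read off its third component. -/
lemma IsAngle.exists_map_comp_eq {X : SuspSeq sus d} (hX : 𝒜.IsAngle X) (i : ℕ)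
    (hi : i + 2 < d + 2) {Y : C} (f : X.obj (i + 1) ⟶ Y) (hf : X.map i ≫ f = 0) :
    ∃ g : X.obj (i + 2) ⟶ Y, X.map (i + 1) ≫ g = f := by
  induction i generalizing X with
  | zero =>
    obtain ⟨φ, h₀, h₁⟩ := 𝒜.extend hX (𝒜.isAngle_shiftedTrivialSeq hd Y) 0 f
      (by rw [zero_comp]; exact hf)
    refine ⟨φ.app 2, (φ.comm 1 (by omega)).trans ?_⟩
    rw [h₁]
    exact Category.comp_id _
  | succ i ih =>
    obtain ⟨R, r, hR⟩ := 𝒜.rotation hX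
    obtain ⟨g, hg⟩ := ih hR (by omega) ((r.iso (i + 1) (by omega)).hom ≫ f) (by
      rw [reassoc_of% r.comm i (by omega), hf, comp_zero])
    refine ⟨(r.iso (i + 2) (by omega)).inv ≫ g, ?_⟩
    rw [← cancel_epi (r.iso (i + 1) (by omega)).hom, ← hg,
      ← reassoc_of% r.comm (i + 1) (by omega), Iso.hom_inv_id_assoc]

lemma IsAngle.exists_conn_comp_eq {X : SuspSeq sus d} (hX : 𝒜.IsAngle X) {Y : C}
    (f : X.obj (d + 1) ⟶ Y) (hf : X.map d ≫ f = 0) :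
    ∃ g : sus.obj (X.obj 0) ⟶ Y, X.conn ≫ g = f := by
  obtain ⟨d, rfl⟩ := Nat.exists_eq_add_of_le' hd
  obtain ⟨R, r, hR⟩ := 𝒜.rotation hX
  obtain ⟨g, hg⟩ := hR.exists_map_comp_eq hd d (by omega) ((r.iso (d + 1) (by omega)).hom ≫ f) (by
    rw [reassoc_of% r.comm d (by omega), hf, comp_zero])
  refine ⟨r.isoLast.inv ≫ g, ?_⟩
  rw [← cancel_epi (r.iso (d + 1) (by omega)).hom, ← hg,
    ← reassoc_of% r.comm_last, Iso.hom_inv_id_assoc]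

end Angulation

/-! ### Resolutions in abelian categories, dimension shifting and splitting. -/

section Resolutions

variable {A : Type u} [Category.{v} A] [Abelian A]

/-- `N` has a coresolution `0 ⟶ N ⟶ D₀ ⟶ ⋯ ⟶ D_n ⟶ 0` by objects of `𝒟`. -/
def HasCoresolution (𝒟 : ObjectProperty A) : ℕ → A → Prop
  | 0, N => 𝒟 N
  | n + 1, N => ∃ (D K : A) (f : N ⟶ D) (g : D ⟶ K) (w : f ≫ g = 0),
      (ShortComplex.mk f g w).ShortExact ∧ 𝒟 D ∧ HasCoresolution 𝒟 n K

/-- `N` has a resolution `0 ⟶ D_n ⟶ ⋯ ⟶ D₀ ⟶ N ⟶ 0` by objects of `𝒟`. -/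
def HasResolution (𝒟 : ObjectProperty A) : ℕ → A → Prop
  | 0, N => 𝒟 N
  | n + 1, N => ∃ (K D : A) (f : K ⟶ D) (g : D ⟶ N) (w : f ≫ g = 0),
      (ShortComplex.mk f g w).ShortExact ∧ 𝒟 D ∧ HasResolution 𝒟 n K

variable {𝒟 : ObjectProperty A}

lemma HasCoresolution.of_iso [𝒟.IsClosedUnderIsomorphisms] {n : ℕ} {N N' : A}
    (h : HasCoresolution 𝒟 n N) (e : N ≅ N') : HasCoresolution 𝒟 n N' := by
  cases n with
  | zero => exact 𝒟.prop_of_iso e h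
  | succ n =>
    obtain ⟨D, K, f, g, w, hS, hD, hK⟩ := h
    have w' : (e.inv ≫ f) ≫ g = 0 := by rw [Category.assoc, w, comp_zero]
    let i : ShortComplex.mk f g w ≅ ShortComplex.mk (e.inv ≫ f) g w' :=
      ShortComplex.isoMk e (Iso.refl _) (Iso.refl _) (by simp) (by simp)
    exact ⟨D, K, e.inv ≫ f, g, w', ShortComplex.shortExact_of_iso i hS, hD, hK⟩

lemma HasResolution.of_iso [𝒟.IsClosedUnderIsomorphisms] {n : ℕ} {N N' : A}
    (h : HasResolution 𝒟 n N) (e : N ≅ N') : HasResolution 𝒟 n N' := by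
  cases n with
  | zero => exact 𝒟.prop_of_iso e h
  | succ n =>
    obtain ⟨K, D, f, g, w, hS, hD, hK⟩ := h
    have w' : f ≫ g ≫ e.hom = 0 := by rw [reassoc_of% w, zero_comp]
    let i : ShortComplex.mk f g w ≅ ShortComplex.mk f (g ≫ e.hom) w' :=
      ShortComplex.isoMk (Iso.refl _) (Iso.refl _) e (by simp) (by simp)
    exact ⟨K, D, f, g ≫ e.hom, w', ShortComplex.shortExact_of_iso i hS, hD, hK⟩

variable [HasExt.{w} A]

lemma retract_of_subsingleton_ext_one {S : ShortComplex A} (hS : S.ShortExact)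
    (h : Subsingleton (Abelian.Ext.{w} S.X₃ S.X₁ 1)) :
    Nonempty (Retract S.X₁ S.X₂) ∧ Nonempty (Retract S.X₃ S.X₂) := by
  constructor
  · obtain ⟨x, hx⟩ := Abelian.Ext.contravariant_sequence_exact₁ hS S.X₁
      (Abelian.Ext.mk₀ (𝟙 _)) (n₁ := 1) rfl (Subsingleton.elim _ _)
    obtain ⟨r, rfl⟩ := (Abelian.Ext.mk₀_bijective _ _).2 x
    rw [Abelian.Ext.mk₀_comp_mk₀] at hx
    exact ⟨⟨S.f, r, (Abelian.Ext.mk₀_bijective _ _).1 hx⟩⟩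
  · obtain ⟨x, hx⟩ := Abelian.Ext.covariant_sequence_exact₃ S.X₃ hS
      (Abelian.Ext.mk₀ (𝟙 _)) (n₁ := 1) rfl (Subsingleton.elim _ _)
    obtain ⟨r, rfl⟩ := (Abelian.Ext.mk₀_bijective _ _).2 x
    rw [Abelian.Ext.mk₀_comp_mk₀] at hx
    exact ⟨⟨r, S.g, (Abelian.Ext.mk₀_bijective _ _).1 hx⟩⟩

/-- Dimension shifting: each coresolution step moves `Ext^j` to `Ext^(j+1)` of the cokernel, so `n`
steps consume `n` of the `m` available degrees. -/
lemma HasCoresolution.subsingleton_ext {N : A} {m : ℕ}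
    (hN : ∀ D, 𝒟 D → ∀ i, 1 ≤ i → i ≤ m → Subsingleton (Abelian.Ext.{w} D N i))
    {n : ℕ} {K : A} (hK : HasCoresolution 𝒟 n K) (j : ℕ) (hj : 1 ≤ j) (hm : j + n ≤ m) :
    Subsingleton (Abelian.Ext.{w} K N j) := by
  induction n generalizing K j with
  | zero => exact hN K hK j hj hm
  | succ n ih =>
    obtain ⟨D, K', f, g, w, hS, hD, hK'⟩ := hK
    have := ih hK' (1 + j) (by omega) (by omega)
    have := hN D hD j hj (by omega)
    refine subsingleton_of_forall_eq 0 fun x => ?_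
    obtain ⟨y, hy⟩ := Abelian.Ext.contravariant_sequence_exact₁ hS N x rfl (Subsingleton.elim _ _)
    rw [← hy, Subsingleton.elim y 0, Abelian.Ext.comp_zero]

lemma HasResolution.subsingleton_ext {N : A} {m : ℕ}
    (hN : ∀ D, 𝒟 D → ∀ i, 1 ≤ i → i ≤ m → Subsingleton (Abelian.Ext.{w} N D i))
    {n : ℕ} {K : A} (hK : HasResolution 𝒟 n K) (j : ℕ) (hj : 1 ≤ j) (hm : j + n ≤ m) :
    Subsingleton (Abelian.Ext.{w} N K j) := by
  induction n generalizing K j with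
  | zero => exact hN K hK j hj hm
  | succ n ih =>
    obtain ⟨K', D, f, g, w, hS, hD, hK'⟩ := hK
    have := ih hK' (j + 1) (by omega) (by omega)
    have := hN D hD j hj (by omega)
    refine subsingleton_of_forall_eq 0 fun x => ?_
    obtain ⟨y, hy⟩ := Abelian.Ext.covariant_sequence_exact₃ N hS x rfl (Subsingleton.elim _ _)
    rw [← hy, Subsingleton.elim y 0, Abelian.Ext.zero_comp]

/-- The first cokernel `K` has a coresolution one shorter, so `Ext¹(K, N) = 0` and the first short
exact sequence splits. -/
lemma HasCoresolution.exists_retract {N : A} {n : ℕ} (h : HasCoresolution 𝒟 n N)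
    (hN : ∀ D, 𝒟 D → ∀ i, 1 ≤ i → i ≤ n → Subsingleton (Abelian.Ext.{w} D N i)) :
    ∃ D, 𝒟 D ∧ Nonempty (Retract N D) := by
  cases n with
  | zero => exact ⟨N, h, ⟨Retract.refl N⟩⟩
  | succ n =>
    obtain ⟨D, K, f, g, w, hS, hD, hK⟩ := h
    exact ⟨D, hD, (retract_of_subsingleton_ext_one hS
      (hK.subsingleton_ext hN 1 le_rfl (by omega))).1⟩

lemma HasResolution.exists_retract {N : A} {n : ℕ} (h : HasResolution 𝒟 n N)
    (hN : ∀ D, 𝒟 D → ∀ i, 1 ≤ i → i ≤ n → Subsingleton (Abelian.Ext.{w} N D i)) :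
    ∃ D, 𝒟 D ∧ Nonempty (Retract N D) := by
  cases n with
  | zero => exact ⟨N, h, ⟨Retract.refl N⟩⟩
  | succ n =>
    obtain ⟨K, D, f, g, w, hS, hD, hK⟩ := h
    exact ⟨D, hD, (retract_of_subsingleton_ext_one hS
      (hK.subsingleton_ext hN 1 le_rfl (by omega))).2⟩

/-- `Ext¹(S.X₃, Y) = 0` if each morphism `S.X₁ ⟶ Y` extends to the projective object `S.X₂`. -/
lemma subsingleton_ext_one_of_projective {S : ShortComplex A} (hS : S.ShortExact)
    [Projective S.X₂] {Y : A} (h : ∀ f : S.X₁ ⟶ Y, ∃ g : S.X₂ ⟶ Y, S.f ≫ g = f) :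
    Subsingleton (Abelian.Ext.{w} S.X₃ Y 1) := by
  refine subsingleton_of_forall_eq 0 fun x => ?_
  obtain ⟨y, rfl⟩ := Abelian.Ext.contravariant_sequence_exact₃ hS Y x
    (Abelian.Ext.eq_zero_of_projective _) (n₀ := 0) rfl
  obtain ⟨f, rfl⟩ := (Abelian.Ext.mk₀_bijective _ _).2 y
  obtain ⟨g, rfl⟩ := h f
  rw [← Abelian.Ext.mk₀_comp_mk₀, ← Abelian.Ext.comp_assoc_of_second_deg_zero,
    hS.extClass_comp, Abelian.Ext.zero_comp]

lemma subsingleton_ext_succ_of_projective {S : ShortComplex A} (hS : S.ShortExact)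
    [Projective S.X₂] {Y : A} {i : ℕ} (h : Subsingleton (Abelian.Ext.{w} S.X₁ Y i)) :
    Subsingleton (Abelian.Ext.{w} S.X₃ Y (i + 1)) := by
  refine subsingleton_of_forall_eq 0 fun x => ?_
  obtain ⟨y, rfl⟩ := Abelian.Ext.contravariant_sequence_exact₃ hS Y x
    (Abelian.Ext.eq_zero_of_projective _) (n₀ := i) (add_comm 1 i)
  rw [Subsingleton.elim y 0, Abelian.Ext.comp_zero]

end Resolutions

/-! ### Cutting exact sequences of modules into short exact ones. -/

section Ranges

variable {R : Type u} [Ring R] {M N P : Type v} [AddCommGroup M] [AddCommGroup N] [AddCommGroup P]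
  [Module R M] [Module R N] [Module R P]

/-- The short complex `range f ⟶ N ⟶ range g` of an exact pair `M ⟶ N ⟶ P`. -/
def rangeComplex (f : M →ₗ[R] N) (g : N →ₗ[R] P) (h : Function.Exact f g) :
    ShortComplex (ModuleCat.{v} R) :=
  ShortComplex.mk (ModuleCat.ofHom (LinearMap.range f).subtype) (ModuleCat.ofHom g.rangeRestrict) (by
    refine ModuleCat.hom_ext (LinearMap.ext ?_)
    rintro ⟨_, x, rfl⟩
    exact Subtype.ext (h.apply_apply_eq_zero x))

lemma rangeComplex_shortExact (f : M →ₗ[R] N) (g : N →ₗ[R] P) (h : Function.Exact f g) :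
    (rangeComplex f g h).ShortExact where
  exact := by
    rw [ShortComplex.moduleCat_exact_iff]
    intro x hx
    obtain ⟨y, hy⟩ := (h x).1 (congrArg Subtype.val hx)
    exact ⟨⟨x, y, hy⟩, rfl⟩
  mono_f := (ModuleCat.mono_iff_injective _).2 Subtype.val_injective
  epi_g := (ModuleCat.epi_iff_surjective _).2 g.surjective_rangeRestrict

lemma hasCoresolution_succ_range {𝒟 : ObjectProperty (ModuleCat.{v} R)} (f : M →ₗ[R] N)
    (g : N →ₗ[R] P) (h : Function.Exact f g) {n : ℕ} (hN : 𝒟 (ModuleCat.of R N))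
    (hg : HasCoresolution 𝒟 n (ModuleCat.of R (LinearMap.range g))) :
    HasCoresolution 𝒟 (n + 1) (ModuleCat.of R (LinearMap.range f)) :=
  ⟨_, _, _, _, _, rangeComplex_shortExact f g h, hN, hg⟩

lemma hasResolution_succ_range {𝒟 : ObjectProperty (ModuleCat.{v} R)} (f : M →ₗ[R] N)
    (g : N →ₗ[R] P) (h : Function.Exact f g) {n : ℕ} (hN : 𝒟 (ModuleCat.of R N))
    (hg : HasResolution 𝒟 n (ModuleCat.of R (LinearMap.range f))) :
    HasResolution 𝒟 (n + 1) (ModuleCat.of R (LinearMap.range g)) :=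
  ⟨_, _, _, _, _, rangeComplex_shortExact f g h, hN, hg⟩

end Ranges

/-! ### Projective dimension of arbitrary direct sums of copies of a module. -/

section DirectSums

variable {R : Type v} [Ring R]

/-- All direct sums of copies of `M` have projective dimension at most `n`. -/
def HasUniformProjDimLE (M : ModuleCat.{v} R) (n : ℕ) : Prop :=
  ∀ B : Type v, HasProjectiveDimensionLE (ModuleCat.of R (B →₀ M)) n

lemma HasUniformProjDimLE.of_iso {M N : ModuleCat.{v} R} {n : ℕ} (h : HasUniformProjDimLE M n)
    (e : M ≅ N) : HasUniformProjDimLE N n := fun B =>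
  have := h B
  hasProjectiveDimensionLT_of_iso
    (Finsupp.mapRange.linearEquiv e.toLinearEquiv : (B →₀ M) ≃ₗ[R] (B →₀ N)).toModuleIso (n + 1)

lemma hasUniformProjDimLE_zero (M : ModuleCat.{v} R) [Module.Projective R M] :
    HasUniformProjDimLE M 0 := fun B =>
  have : Module.Projective R (B →₀ M) := by
    classical exact .of_equiv (finsuppLequivDFinsupp R).symm
  have : Projective (ModuleCat.of R (B →₀ M)) := (IsProjective.iff_projective _).1 this
  inferInstance

/-- Taking direct sums of copies of a short exact sequence. -/
lemma HasUniformProjDimLE.succ {S : ShortComplex (ModuleCat.{v} R)} (hS : S.ShortExact) {n : ℕ}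
    (h₂ : HasUniformProjDimLE S.X₂ 0) (h₁ : HasUniformProjDimLE S.X₁ n) :
    HasUniformProjDimLE S.X₃ (n + 1) := fun B => by
  let T : ShortComplex (ModuleCat.{v} R) := ShortComplex.mk
    (ModuleCat.ofHom (Finsupp.mapRange.linearMap (α := B) S.f.hom))
    (ModuleCat.ofHom (Finsupp.mapRange.linearMap (α := B) S.g.hom)) (by
      ext x : 3
      simp [← ModuleCat.comp_apply])
  have hT : T.ShortExact :=
    { exact := by
        have h := (ShortComplex.moduleCat_exact_iff_range_eq_ker _).1 hS.exact
        rw [ShortComplex.moduleCat_exact_iff_range_eq_ker]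
        dsimp only [T, ModuleCat.hom_ofHom]
        rw [Finsupp.ker_mapRange, Finsupp.range_mapRange_linearMap _
          (LinearMap.ker_eq_bot.2 hS.moduleCat_injective_f), h]
      mono_f := (ModuleCat.mono_iff_injective _).2
        (Finsupp.mapRange_injective _ (map_zero _) hS.moduleCat_injective_f)
      epi_g := (ModuleCat.epi_iff_surjective _).2
        (Finsupp.mapRange_surjective _ (map_zero _) hS.moduleCat_surjective_g) }
  have := h₁ B
  have := h₂ B
  exact hT.hasProjectiveDimensionLT_X₃ (n + 1) (h₁ B)
    (hasProjectiveDimensionLT_of_ge _ 1 _ (by omega))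

end DirectSums

/-! ### The objects of `add M` through decompositions of the identity. -/

section Add

variable {C : Type u} [Category.{v} C] [Preadditive C] [HasFiniteBiproducts C]

/-- The matrix entries of the inclusion and of the retraction. This form mentions no biproduct, so
additive functors visibly preserve it. -/
lemma add_iff {M X : C} :
    add M X ↔ ∃ (n : ℕ) (a : Fin n → (X ⟶ M)) (b : Fin n → (M ⟶ X)), ∑ j, a j ≫ b j = 𝟙 X := by
  constructor
  · rintro ⟨n, ⟨r⟩⟩
    refine ⟨n, fun j => r.i ≫ biproduct.π _ j, fun j => biproduct.ι (fun _ : Fin n => M) j ≫ r.r, ?_⟩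
    have h := congrArg (fun z => r.i ≫ z ≫ r.r) (biproduct.total (f := fun _ : Fin n => M))
    simp only [Preadditive.sum_comp, Preadditive.comp_sum, Category.assoc, Category.id_comp,
      r.retract] at h
    simp only [Category.assoc]
    convert h
  · rintro ⟨n, a, b, h⟩
    exact ⟨n, ⟨⟨biproduct.lift a, biproduct.desc b, by rw [biproduct.lift_desc, h]⟩⟩⟩

lemma add_biproduct (M : C) (n : ℕ) : add M (⨁ fun _ : Fin n => M) := ⟨n, ⟨Retract.refl _⟩⟩

lemma add_of_iso {M X Y : C} (e : X ≅ Y) (h : add M X) : add M Y := by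
  obtain ⟨n, ⟨r⟩⟩ := h
  exact ⟨n, ⟨⟨e.inv ≫ r.i, r.r ≫ e.hom, by simp⟩⟩⟩

lemma eq_zero_of_add {M X Y : C} (h : add M X) (f : X ⟶ Y) (hf : ∀ t : M ⟶ X, t ≫ f = 0) :
    f = 0 := by
  obtain ⟨n, a, b, h⟩ := add_iff.1 h
  rw [← Category.id_comp f, ← h, Preadditive.sum_comp]
  exact Finset.sum_eq_zero fun j _ => by rw [Category.assoc, hf, comp_zero]

lemma hom_eq_zero_of_add_left {D : Type*} [Category D] [Preadditive D] (H : C ⥤ D) [H.Additive]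
    {M X : C} (h : add M X) {Z : D} (hM : ∀ f : H.obj M ⟶ Z, f = 0) (f : H.obj X ⟶ Z) : f = 0 := by
  obtain ⟨n, a, b, h⟩ := add_iff.1 h
  rw [← Category.id_comp f, ← H.map_id, ← h, H.map_sum, Preadditive.sum_comp]
  exact Finset.sum_eq_zero fun j _ => by rw [H.map_comp, Category.assoc, hM (_ ≫ f), comp_zero]

lemma hom_eq_zero_of_add_right {D : Type*} [Category D] [Preadditive D] (H : C ⥤ D) [H.Additive]
    {M X : C} (h : add M X) {Z : D} (hM : ∀ f : Z ⟶ H.obj M, f = 0) (f : Z ⟶ H.obj X) : f = 0 := by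
  obtain ⟨n, a, b, h⟩ := add_iff.1 h
  rw [← Category.comp_id f, ← H.map_id, ← h, H.map_sum, Preadditive.comp_sum]
  exact Finset.sum_eq_zero fun j _ => by
    rw [H.map_comp, ← Category.assoc, hM (f ≫ _), zero_comp]

end Add

/-! ### The modules `Hom(T, X)` for `X` in `add T`: fullness, projectivity, presentations. -/

section HomModules

variable {C : Type u} [Category.{v} C] [Preadditive C]

/-- Composition with `f`, as a homomorphism of right `End T`-modules. -/
def postcomp (T : C) {X Y : C} (f : X ⟶ Y) : (T ⟶ X) →ₗ[(End T)ᵐᵒᵖ] (T ⟶ Y) :=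
  ((preadditiveCoyonedaObj T).map f).hom

@[simp]
lemma postcomp_apply (T : C) {X Y : C} (f : X ⟶ Y) (t : T ⟶ X) : postcomp T f t = t ≫ f := rfl

/-- An endomorphism of `T`, as a scalar of right `End T`-modules. -/
def endOp {T : C} (a : T ⟶ T) : (End T)ᵐᵒᵖ := MulOpposite.op a

lemma endOp_smul {T X : C} (a : T ⟶ T) (t : T ⟶ X) : endOp a • t = a ≫ t := rfl

lemma endOp_add {T : C} (a b : T ⟶ T) : endOp (a + b) = endOp a + endOp b := rfl

omit [Preadditive C] in
lemma endOp_comp {T : C} (a b : T ⟶ T) : endOp (a ≫ b) = endOp a * endOp b := rfl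

omit [Preadditive C] in
lemma endOp_id (T : C) : endOp (𝟙 T) = 1 := rfl

omit [Preadditive C] in
lemma endOp_surjective {T : C} (c : (End T)ᵐᵒᵖ) : ∃ a : T ⟶ T, endOp a = c := ⟨c.unop, rfl⟩

/-- Yoneda's lemma for `T`, extended to `add T`: the map is determined by its values at the `b j`.
-/
lemma exists_map_eq_of_add [HasFiniteBiproducts C] {T X Y : C} (h : add T X)
    (f : (T ⟶ X) →ₗ[(End T)ᵐᵒᵖ] (T ⟶ Y)) : ∃ g : X ⟶ Y, postcomp T g = f := by
  obtain ⟨n, a, b, h⟩ := add_iff.1 h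
  refine ⟨∑ j, a j ≫ f (b j), LinearMap.ext fun t => ?_⟩
  conv_rhs => rw [← Category.comp_id t, ← h, Preadditive.comp_sum, map_sum]
  rw [postcomp_apply, Preadditive.comp_sum]
  refine Finset.sum_congr rfl fun j _ => ?_
  rw [← Category.assoc, ← Category.assoc, ← endOp_smul (t ≫ a j) (f (b j)), ← map_smul]
  rfl

/-- The homomorphism from `Hom(T, X)` determined by the values `x j` at `b j`, where
`∑ j, a j ≫ b j = 𝟙`. -/
def homOfFamily {T X : C} {N : Type*} [AddCommGroup N] [Module (End T)ᵐᵒᵖ N] {n : ℕ}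
    (a : Fin n → (X ⟶ T)) (x : Fin n → N) : (T ⟶ X) →ₗ[(End T)ᵐᵒᵖ] N where
  toFun t := ∑ j, endOp (t ≫ a j) • x j
  map_add' s t := by
    rw [← Finset.sum_add_distrib]
    refine Finset.sum_congr rfl fun j _ => ?_
    rw [← add_smul, ← endOp_add, Preadditive.add_comp]
  map_smul' c t := by
    obtain ⟨c, rfl⟩ := endOp_surjective c
    rw [RingHom.id_apply, Finset.smul_sum]
    refine Finset.sum_congr rfl fun j _ => ?_
    rw [smul_smul, ← endOp_comp, endOp_smul, Category.assoc]

lemma homOfFamily_apply {T X : C} {N : Type*} [AddCommGroup N] [Module (End T)ᵐᵒᵖ N] {n : ℕ}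
    (a : Fin n → (X ⟶ T)) (x : Fin n → N) (t : T ⟶ X) :
    homOfFamily a x t = ∑ j, endOp (t ≫ a j) • x j := rfl

lemma map_eq_sum_of_total {T X : C} {N : Type*} [AddCommGroup N] [Module (End T)ᵐᵒᵖ N] {n : ℕ}
    {a : Fin n → (X ⟶ T)} {b : Fin n → (T ⟶ X)} (h : ∑ j, a j ≫ b j = 𝟙 X)
    (f : (T ⟶ X) →ₗ[(End T)ᵐᵒᵖ] N) : f = homOfFamily a fun j => f (b j) := by
  refine LinearMap.ext fun t => ?_
  conv_lhs => rw [← Category.comp_id t, ← h, Preadditive.comp_sum, map_sum]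
  refine Finset.sum_congr rfl fun j _ => ?_
  rw [← map_smul, endOp_smul, Category.assoc]

lemma projective_of_add [HasFiniteBiproducts C] {T X : C} (h : add T X) :
    Module.Projective (End T)ᵐᵒᵖ (T ⟶ X) := by
  obtain ⟨n, a, b, h⟩ := add_iff.1 h
  refine Module.Projective.of_lifting_property'' fun f hf => ?_
  choose y hy using hf
  refine ⟨homOfFamily a fun j => y (b j), ?_⟩
  rw [map_eq_sum_of_total h LinearMap.id]
  refine LinearMap.ext fun t => ?_
  simp [homOfFamily_apply, hy]

/-- Finitely presented modules are cokernels of maps between finite direct sums of copies of `T`. -/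
lemma exists_presentation [HasFiniteBiproducts C] {T : C} [IsNoetherianRing (End T)ᵐᵒᵖ]
    (N : Type v) [AddCommGroup N] [Module (End T)ᵐᵒᵖ N] [Module.Finite (End T)ᵐᵒᵖ N] :
    ∃ (m n : ℕ) (f : (⨁ fun _ : Fin m => T) ⟶ (⨁ fun _ : Fin n => T))
      (p : (T ⟶ ⨁ fun _ : Fin n => T) →ₗ[(End T)ᵐᵒᵖ] N),
      Function.Surjective p ∧ Function.Exact (postcomp T f) p := by
  obtain ⟨n, s, hs⟩ := Module.Finite.exists_fin (R := (End T)ᵐᵒᵖ) (M := N)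
  let p : (T ⟶ ⨁ fun _ : Fin n => T) →ₗ[(End T)ᵐᵒᵖ] N := homOfFamily (biproduct.π _) s
  have : Module.Finite (End T)ᵐᵒᵖ (T ⟶ ⨁ fun _ : Fin n => T) := by
    refine Module.Finite.of_surjective
      (Fintype.linearCombination (End T)ᵐᵒᵖ (biproduct.ι fun _ : Fin n => T)) fun t => ?_
    refine ⟨fun j => endOp (t ≫ biproduct.π _ j), ?_⟩
    conv_rhs => rw [← Category.comp_id t, ← biproduct.total, Preadditive.comp_sum]
    rw [Fintype.linearCombination_apply]
    exact Finset.sum_congr rfl fun j _ => Category.assoc _ _ _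
  obtain ⟨m, r, hr⟩ := Submodule.fg_iff_exists_fin_generating_family.1
    (IsNoetherian.noetherian (LinearMap.ker p))
  refine ⟨m, n, biproduct.desc r, p, fun x => ?_, fun t => ?_⟩
  · have hx : x ∈ Submodule.span (End T)ᵐᵒᵖ (Set.range s) := hs ▸ Submodule.mem_top
    obtain ⟨c, hc⟩ := (Submodule.mem_span_range_iff_exists_fun _).1 hx
    refine ⟨biproduct.lift fun j => (c j).unop, ?_⟩
    rw [← hc, homOfFamily_apply]
    exact Finset.sum_congr rfl fun j _ => by rw [biproduct.lift_π]; rfl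
  · rw [← LinearMap.mem_ker, ← hr, Submodule.mem_span_range_iff_exists_fun]
    constructor
    · rintro ⟨c, rfl⟩
      refine ⟨biproduct.lift fun j => (c j).unop, ?_⟩
      rw [postcomp_apply, biproduct.lift_desc]
      rfl
    · rintro ⟨c, rfl⟩
      refine ⟨fun j => endOp (c ≫ biproduct.π _ j), ?_⟩
      conv_rhs => rw [postcomp_apply, ← Category.comp_id c, ← biproduct.total,
        Preadditive.comp_sum, Preadditive.sum_comp]
      refine Finset.sum_congr rfl fun j _ => ?_
      rw [endOp_smul]
      simp

end HomModules

/-! ### Lifting idempotents in finite dimensional algebras. -/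

section Idempotents

/-- In the finite dimensional commutative algebra `k[a]` the ideals `(a^n)` stabilize, so `a^(n+1) y
= a^n` for some `y`, and `e = (a y)^(n+1)` is idempotent. If `φ a` is idempotent, the relation
reduces to `φ a * φ y = φ a`, whence `φ e = φ a`. Only multiplicativity of `φ` enters. -/
lemma exists_idempotent_lift (k : Type*) [Field k] {A : Type*} [Ring A] [Algebra k A]
    [Module.Finite k A] (a : A) :
    ∃ e : A, IsIdempotentElem e ∧ ∀ {B : Type v} [Monoid B] (φ : A →* B),
      IsIdempotentElem (φ a) → φ e = φ a := by
  let S := Algebra.adjoin k {a}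
  have := Algebra.isMulCommutative_adjoin k (s := {a}) (by simp)
  let _ : CommRing S := inferInstance
  have : Module.Finite k S := inferInstance
  have : IsArtinianRing S := IsArtinianRing.of_finite k S
  let α : S := ⟨a, Algebra.subset_adjoin rfl⟩
  obtain ⟨n, y, hy⟩ := IsArtinian.exists_pow_succ_smul_dvd α (1 : S)
  have h₁ : α ^ (n + 1) * (α * y) = α ^ (n + 1) := by
    have : α ^ (n + 1) * y = α ^ n * 1 := hy
    linear_combination α * this
  have h₂ : ∀ j, α ^ (n + 1) * (α * y) ^ j = α ^ (n + 1) := by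
    intro j
    induction j with
    | zero => simp
    | succ j ih => rw [pow_succ (α * y), ← mul_assoc, ih, h₁]
  refine ⟨((α * y) ^ (n + 1) : S), ?_, fun {B} _ φ hφ => ?_⟩
  · have h : (α * y) ^ (n + 1) * (α * y) ^ (n + 1) = (α * y) ^ (n + 1) := by
      have := h₂ (n + 1)
      have h' := mul_pow α y (n + 1)
      calc _ = y ^ (n + 1) * (α ^ (n + 1) * (α * y) ^ (n + 1)) := by rw [← mul_assoc, h']; ring
        _ = _ := by rw [this, h', mul_comm]
    exact congrArg Subtype.val h
  · have h : a ^ (n + 1) * (a * (y : A)) = a ^ (n + 1) := congrArg Subtype.val h₁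
    have h' := congrArg φ h
    simp only [map_mul, map_pow, hφ.pow_succ_eq] at h'
    rw [← mul_assoc, hφ.eq] at h'
    change φ ((a * (y : A)) ^ (n + 1)) = φ a
    rw [map_pow, map_mul, h', hφ.pow_succ_eq]

end Idempotents

lemma subsingleton_ext_of_iso {A : Type u} [Category.{v} A] [Abelian A] [HasExt.{w} A]
    {M M' N N' : A} (e : M ≅ M') (e' : N ≅ N') {i : ℕ}
    (h : Subsingleton (Abelian.Ext.{w} M N i)) : Subsingleton (Abelian.Ext.{w} M' N' i) := by
  refine subsingleton_of_forall_eq 0 fun x => ?_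
  have h₁ : ((Abelian.Ext.mk₀ e.hom).comp x (zero_add i)).comp (Abelian.Ext.mk₀ e'.inv)
    (add_zero i) = 0 := Subsingleton.elim _ _
  have h₂ : (Abelian.Ext.mk₀ e.hom).comp x (zero_add i) = 0 := by
    have := congrArg (fun z => Abelian.Ext.comp z (Abelian.Ext.mk₀ e'.hom) (add_zero i)) h₁
    simpa [Abelian.Ext.comp_assoc_of_third_deg_zero, Abelian.Ext.mk₀_comp_mk₀] using this
  have := congrArg (fun z => (Abelian.Ext.mk₀ e.inv).comp z (zero_add i)) h₂
  simpa [← Abelian.Ext.comp_assoc_of_second_deg_zero, Abelian.Ext.mk₀_comp_mk₀] using this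

section LinearMaps

variable {R : Type*} [Ring R] {M N P : Type*} [AddCommGroup M] [AddCommGroup N] [AddCommGroup P]
  [Module R M] [Module R N] [Module R P]

/-- The range of a linear map with the same kernel as a surjection `p` is the target of `p`. -/
noncomputable def rangeEquivOfKerEq (p : M →ₗ[R] N) (hp : Function.Surjective p) (g : M →ₗ[R] P)
    (h : LinearMap.ker p = LinearMap.ker g) : N ≃ₗ[R] LinearMap.range g :=
  (p.quotKerEquivOfSurjective hp).symm.trans
    ((Submodule.quotEquivOfEq _ _ h).trans g.quotKerEquivRange)

end LinearMaps

/-! ### Fullness, Ext vanishing and projective dimension from angles with terms in `add T`. -/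

section Angles

variable {C : Type u} [Category.{v} C] [Preadditive C] [HasFiniteBiproducts C]
  {sus : C ⥤ C} {d : ℕ} {𝒜 : Angulation sus d} (hd : 1 ≤ d) [sus.IsEquivalence]

lemma additive_of_isEquivalence {D : Type*} [Category D] [Preadditive D] (H : C ⥤ D)
    [H.IsEquivalence] : H.Additive := by
  have := hasBinaryBiproducts_of_finite_biproducts C
  exact Functor.additive_of_preserves_binary_products _

include hd in
lemma Angulation.IsAngle.exact_postcomp {X : SuspSeq sus d} (hX : 𝒜.IsAngle X) (T : C) (i : ℕ)
    (hi : i + 2 < d + 2) :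
    Function.Exact (postcomp T (X.map i)) (postcomp T (X.map (i + 1))) := by
  intro t
  constructor
  · exact hX.exists_comp_map_eq hd i hi t
  · rintro ⟨s, rfl⟩
    simp [hX.map_comp_map hd i hi]

include hd in
lemma Angulation.IsAngle.surjective_postcomp {X : SuspSeq sus d} (hX : 𝒜.IsAngle X) {T : C}
    (hT : ∀ f : T ⟶ sus.obj (X.obj 0), f = 0) : Function.Surjective (postcomp T (X.map d)) :=
  fun t => hX.exists_comp_map_last_eq hd t (hT _)

section Fullness

variable {T : C} (hT : ∀ f : T ⟶ sus.obj T, f = 0)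

include hT in
lemma hom_sus_eq_zero {X : C} (h : add T X) (f : T ⟶ sus.obj X) : f = 0 :=
  have := additive_of_isEquivalence sus
  hom_eq_zero_of_add_right sus h hT f

variable {X : SuspSeq sus d} (hX : 𝒜.IsAngle X) (hadd : ∀ (i : ℕ) (hi : i < d + 1), add T (X.obj i))

include hd hT hX hadd

lemma exists_postcomp_eq_of_angle {Y : C} (f : (T ⟶ X.obj (d + 1)) →ₗ[(End T)ᵐᵒᵖ] (T ⟶ Y)) :
    ∃ g : X.obj (d + 1) ⟶ Y, postcomp T g = f := by
  obtain ⟨d, rfl⟩ := Nat.exists_eq_add_of_le' hd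
  obtain ⟨u, hu⟩ := exists_map_eq_of_add (hadd (d + 1) (by omega))
    -- On the projective cover term the map comes from a morphism `u`; `u` kills the preceding map
    -- of the angle, as is tested on morphisms from `T`, and so factors through the last object.
    (f ∘ₗ postcomp T (X.map (d + 1)))
  have hu' (t : T ⟶ X.obj (d + 1)) : t ≫ u = f (t ≫ X.map (d + 1)) := LinearMap.congr_fun hu t
  obtain ⟨g, hg⟩ := hX.exists_map_comp_eq hd d (by omega) u
    (eq_zero_of_add (hadd d (by omega)) _ fun t => by
      rw [← Category.assoc, hu', Category.assoc, hX.map_comp_map hd d (by omega), comp_zero,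
        map_zero])
  refine ⟨g, LinearMap.ext fun t => ?_⟩
  obtain ⟨s, rfl⟩ := hX.surjective_postcomp hd (hom_sus_eq_zero hT (hadd 0 (by omega))) t
  rw [postcomp_apply, postcomp_apply, Category.assoc, hg, hu']

omit hT in
-- A substitute for faithfulness of `Hom(T, -)`: a morphism invisible to `T` factors through
-- `X.conn`, hence through `Σ` of an object of `add T`.
lemma eq_zero_of_angle {Z : C} (hZ : ∀ f : sus.obj T ⟶ Z, f = 0) (f : X.obj (d + 1) ⟶ Z)
    (hf : ∀ t : T ⟶ X.obj (d + 1), t ≫ f = 0) : f = 0 := by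
  obtain ⟨g, rfl⟩ := hX.exists_conn_comp_eq hd f
    (eq_zero_of_add (hadd d (by omega)) _ fun t => by rw [← Category.assoc, hf])
  have := additive_of_isEquivalence sus
  rw [hom_eq_zero_of_add_left sus (hadd 0 (by omega)) hZ g, comp_zero]

omit hT in
-- Each dimension shift lowers `j` and `i` by one. For `i = 1` a map from the preceding image is
-- induced by some `X.obj (j - 1) ⟶ Y` killing `X.map (j - 2)`, which extends to `X.obj j`; this is
-- why `i + 1 ≤ j` is required. The case `j = d` covers exactly `i ≤ d - 1`.
lemma subsingleton_ext_range (Y : C) (i : ℕ) (hi : 1 ≤ i) (j : ℕ) (hj : j + 1 < d + 2)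
    (hij : i + 1 ≤ j) : Subsingleton (Abelian.Ext.{v}
      (ModuleCat.of (End T)ᵐᵒᵖ (LinearMap.range (postcomp T (X.map j))))
      (ModuleCat.of (End T)ᵐᵒᵖ (T ⟶ Y)) i) := by
  induction i, hi using Nat.le_induction generalizing j with
  | base =>
    obtain ⟨j, rfl⟩ := Nat.exists_eq_add_of_le' hij
    have := projective_of_add (hadd (j + 2) (by omega))
    have hS := rangeComplex_shortExact _ _ (hX.exact_postcomp hd T (j + 1) (by omega))
    have : Projective (rangeComplex _ _ (hX.exact_postcomp hd T (j + 1) (by omega))).X₂ :=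
      (IsProjective.iff_projective _).1 this
    refine subsingleton_ext_one_of_projective hS fun f => ?_
    obtain ⟨u, hu⟩ := exists_map_eq_of_add (hadd (j + 1) (by omega))
      (f.hom ∘ₗ (postcomp T (X.map (j + 1))).rangeRestrict)
    have hu' (t : T ⟶ X.obj (j + 1)) : t ≫ u = f.hom ⟨t ≫ X.map (j + 1), t, rfl⟩ :=
      LinearMap.congr_fun hu t
    obtain ⟨g, hg⟩ := hX.exists_map_comp_eq hd j (by omega) u
      (eq_zero_of_add (hadd j (by omega)) _ fun t => by
        rw [← Category.assoc, hu', ← map_zero f.hom]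
        congr 1
        exact Subtype.ext (show (t ≫ X.map j) ≫ X.map (j + 1) = 0 by
          rw [Category.assoc, hX.map_comp_map hd j (by omega), comp_zero]))
    refine ⟨ModuleCat.ofHom (postcomp T g), ModuleCat.hom_ext (LinearMap.ext ?_)⟩
    rintro ⟨_, t, rfl⟩
    change (t ≫ X.map (j + 1)) ≫ g = f.hom ⟨t ≫ X.map (j + 1), t, rfl⟩
    rw [Category.assoc, hg, hu']
  | succ i hi ih =>
    obtain ⟨j, rfl⟩ := Nat.exists_eq_add_of_le' (show 1 ≤ j by omega)
    have := projective_of_add (hadd (j + 1) (by omega))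
    have hE := hX.exact_postcomp hd T j hj
    have : Projective (rangeComplex _ _ hE).X₂ := (IsProjective.iff_projective _).1 this
    exact subsingleton_ext_succ_of_projective (rangeComplex_shortExact _ _ hE)
      (ih j (by omega) (by omega))

omit hT in
lemma hasUniformProjDimLE_range (h₀ : ∀ f : sus.obj T ⟶ X.obj (d + 1), f = 0) (j : ℕ)
    (hj : j + 1 < d + 2) : HasUniformProjDimLE
      (ModuleCat.of (End T)ᵐᵒᵖ (LinearMap.range (postcomp T (X.map j)))) j := by
  induction j with
  | zero =>
    have := projective_of_add (hadd 0 (by omega))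
    refine (hasUniformProjDimLE_zero (ModuleCat.of (End T)ᵐᵒᵖ (T ⟶ X.obj 0 _))).of_iso
      (LinearEquiv.ofInjective (postcomp T (X.map 0)) ?_).toModuleIso
    -- An element of the kernel, once suspended, factors through a morphism `Σ T ⟶ X.obj (d + 1)`,
    -- which vanishes by `h₀`.
    refine (injective_iff_map_eq_zero _).2 fun t ht => sus.map_injective ?_
    have := additive_of_isEquivalence sus
    obtain ⟨g, hg⟩ := hX.exists_comp_conn_eq hd t ht
    rw [← hg, h₀ g, zero_comp, sus.map_zero]
  | succ j ih =>
    have := projective_of_add (hadd (j + 1) (by omega))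
    have hE := hX.exact_postcomp hd T j hj
    exact HasUniformProjDimLE.succ (rangeComplex_shortExact _ _ hE)
      (hasUniformProjDimLE_zero (ModuleCat.of (End T)ᵐᵒᵖ (T ⟶ X.obj (j + 1) _))) (ih (by omega))

end Fullness

section ClusterTilting

variable {T : C} (hT : IsOTClusterTilting 𝒜 T)

include hd hT

lemma IsOTClusterTilting.exists_postcomp_eq {X Y : C}
    (f : (T ⟶ X) →ₗ[(End T)ᵐᵒᵖ] (T ⟶ Y)) : ∃ g : X ⟶ Y, postcomp T g = f := by
  obtain ⟨A, hA, hadd, ⟨e⟩⟩ := hT.2 X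
  obtain ⟨g, hg⟩ := exists_postcomp_eq_of_angle hd hT.1 hA hadd (f ∘ₗ postcomp T e.hom)
  refine ⟨e.inv ≫ g, LinearMap.ext fun t => ?_⟩
  have := LinearMap.congr_fun hg (t ≫ e.inv)
  simpa using this

lemma IsOTClusterTilting.eq_zero {X Z : C} (hZ : ∀ f : sus.obj T ⟶ Z, f = 0) (f : X ⟶ Z)
    (hf : ∀ t : T ⟶ X, t ≫ f = 0) : f = 0 := by
  obtain ⟨A, hA, hadd, ⟨e⟩⟩ := hT.2 X
  rw [← cancel_epi e.hom, comp_zero]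
  exact eq_zero_of_angle hd hA hadd hZ _ fun t => by rw [← Category.assoc, hf]

lemma IsOTClusterTilting.exists_rangeIso (X : C) : ∃ A : SuspSeq sus d, 𝒜.IsAngle A ∧
    (∀ (i : ℕ) (hi : i < d + 1), add T (A.obj i)) ∧ Nonempty (A.obj (d + 1) ≅ X) ∧
    Nonempty (ModuleCat.of (End T)ᵐᵒᵖ (LinearMap.range (postcomp T (A.map d))) ≅
      (preadditiveCoyonedaObj T).obj X) := by
  obtain ⟨A, hA, hadd, ⟨e⟩⟩ := hT.2 X
  have := hA.surjective_postcomp hd (hom_sus_eq_zero hT.1 (hadd 0 (by omega)))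
  exact ⟨A, hA, hadd, ⟨e⟩, ⟨(LinearEquiv.ofTop _ (LinearMap.range_eq_top.2 this)).toModuleIso ≪≫
    (preadditiveCoyonedaObj T).mapIso e⟩⟩

lemma IsOTClusterTilting.subsingleton_ext {M N : ModuleCat.{v} (End T)ᵐᵒᵖ}
    (hM : (preadditiveCoyonedaObj T).essImage M) (hN : (preadditiveCoyonedaObj T).essImage N)
    (i : ℕ) (hi : 1 ≤ i) (hid : i ≤ d - 1) : Subsingleton (Abelian.Ext.{v} M N i) := by
  obtain ⟨X, ⟨eX⟩⟩ := hM
  obtain ⟨Y, ⟨eY⟩⟩ := hN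
  obtain ⟨A, hA, hadd, -, ⟨e⟩⟩ := hT.exists_rangeIso hd X
  exact subsingleton_ext_of_iso (e ≪≫ eX) eY
    (subsingleton_ext_range hd hA hadd Y i hi d (by omega) (by omega))

lemma IsOTClusterTilting.hasUniformProjDimLE {X : C} (h₀ : ∀ f : sus.obj T ⟶ X, f = 0) :
    HasUniformProjDimLE ((preadditiveCoyonedaObj T).obj X) d := by
  obtain ⟨A, hA, hadd, ⟨e'⟩, ⟨e⟩⟩ := hT.exists_rangeIso hd X
  exact (hasUniformProjDimLE_range hd hA hadd (fun f => by
    rw [← cancel_mono e'.hom, h₀ (f ≫ e'.hom), zero_comp]) d (by omega)).of_iso e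

/-- The retract is cut out by an idempotent of `Hom(T, X)`. Fullness lifts it to some endomorphism
`a` of `X`, which is replaced by an idempotent with the same image; splitting that one gives the
required object. -/
lemma IsOTClusterTilting.essImage_of_retract (k : Type*) [Field k] [Linear k C]
    (hfin : ∀ X Y : C, Module.Finite k (X ⟶ Y)) [IsIdempotentComplete C]
    {M N : ModuleCat.{v} (End T)ᵐᵒᵖ} (hM : (preadditiveCoyonedaObj T).essImage M)
    (r : Retract N M) : (preadditiveCoyonedaObj T).essImage N := by
  obtain ⟨X, ⟨eX⟩⟩ := hM
  let r' : Retract N ((preadditiveCoyonedaObj T).obj X) :=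
    ⟨r.i ≫ eX.inv, eX.hom ≫ r.r, by simp⟩
  obtain ⟨a, ha⟩ := hT.exists_postcomp_eq hd (r'.r ≫ r'.i).hom
  have ha' : (preadditiveCoyonedaObj T).map a = r'.r ≫ r'.i := ModuleCat.hom_ext ha
  have : Module.Finite k (End X) := hfin X X
  obtain ⟨p, hp, hpa⟩ := exists_idempotent_lift k (A := End X) a
  have h₁ : (preadditiveCoyonedaObj T).map p = r'.r ≫ r'.i := by
    rw [← ha']
    refine hpa (Functor.mapEnd X (preadditiveCoyonedaObj T)) ?_
    change (preadditiveCoyonedaObj T).map a ≫ (preadditiveCoyonedaObj T).map a =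
      (preadditiveCoyonedaObj T).map a
    rw [ha']
    simp
  obtain ⟨Y, i, e, hie, hei⟩ := IsIdempotentComplete.idempotents_split X p hp
  rw [← hei, Functor.map_comp] at h₁
  refine ⟨Y, ⟨⟨(preadditiveCoyonedaObj T).map i ≫ r'.r, r'.i ≫ (preadditiveCoyonedaObj T).map e,
    ?_, ?_⟩⟩⟩
  · rw [Category.assoc, ← reassoc_of% h₁, ← Functor.map_comp, ← Functor.map_comp,
      ← Functor.map_comp, hie, Category.comp_id, hie, (preadditiveCoyonedaObj T).map_id]
  · rw [Category.assoc, reassoc_of% h₁]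
    simp

end ClusterTilting

end Angles

/-! ### Coresolutions and left approximations from projective presentations. -/

section Coresolutions

variable {C : Type u} [Category.{v} C] [Preadditive C] [HasFiniteBiproducts C]
  {sus : C ⥤ C} {d : ℕ}

lemma Angulation.exists_angle_of_finite (𝒜 : Angulation sus d) {T : C}
    [IsNoetherianRing (End T)ᵐᵒᵖ] (N : Type v) [AddCommGroup N] [Module (End T)ᵐᵒᵖ N]
    [Module.Finite (End T)ᵐᵒᵖ N] : ∃ X : SuspSeq sus d, 𝒜.IsAngle X ∧ add T (X.obj 0) ∧
      add T (X.obj 1) ∧ ∃ p : (T ⟶ X.obj 1) →ₗ[(End T)ᵐᵒᵖ] N,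
      Function.Surjective p ∧ Function.Exact (postcomp T (X.map 0)) p := by
  obtain ⟨m, n, f, p, hp, hfp⟩ := exists_presentation (T := T) N
  obtain ⟨X, hX, e₀, e₁, h⟩ := 𝒜.complete f
  refine ⟨X, hX, add_of_iso e₀.symm (add_biproduct T m), add_of_iso e₁.symm (add_biproduct T n),
    p ∘ₗ postcomp T e₁.hom, fun x => ?_, fun t => ?_⟩
  · obtain ⟨t, rfl⟩ := hp x
    exact ⟨t ≫ e₁.inv, by simp⟩
  · refine (hfp (t ≫ e₁.hom)).trans ⟨?_, ?_⟩
    · rintro ⟨s, hs⟩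
      refine ⟨s ≫ e₀.inv, ?_⟩
      rw [postcomp_apply] at hs ⊢
      rw [← cancel_mono e₁.hom, Category.assoc, h, ← hs]
      simp
    · rintro ⟨s, rfl⟩
      exact ⟨s ≫ e₀.hom, by simp [h]⟩

variable {𝒜 : Angulation sus d} (hd : 1 ≤ d) [sus.IsEquivalence]

include hd

lemma Angulation.IsAngle.hasCoresolution_range {X : SuspSeq sus d} (hX : 𝒜.IsAngle X) {T : C}
    (h₀ : ∀ f : T ⟶ sus.obj (X.obj 0), f = 0) (n i : ℕ) (hi : i + 1 < d + 2) (hin : i + n = d) :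
    HasCoresolution (preadditiveCoyonedaObj T).essImage n
      (ModuleCat.of (End T)ᵐᵒᵖ (LinearMap.range (postcomp T (X.map i)))) := by
  induction n generalizing i with
  | zero =>
    obtain rfl : i = d := hin
    exact ⟨_, ⟨(LinearEquiv.ofTop _ (LinearMap.range_eq_top.2
      (hX.surjective_postcomp hd h₀))).toModuleIso.symm⟩⟩
  | succ n ih =>
    have hi' : i + 2 < d + 2 := by omega
    exact hasCoresolution_succ_range _ _ (hX.exact_postcomp hd T i hi') ⟨_, ⟨Iso.refl _⟩⟩
      (ih (i + 1) hi' (by omega))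

lemma IsOTClusterTilting.exists_left_approximation {T : C} (hT : IsOTClusterTilting 𝒜 T)
    [IsNoetherianRing (End T)ᵐᵒᵖ] (N : ModuleCat.{v} (End T)ᵐᵒᵖ) [Module.Finite (End T)ᵐᵒᵖ N] :
    HasCoresolution (preadditiveCoyonedaObj T).essImage (d - 1) N ∧
    ∃ (X : ModuleCat.{v} (End T)ᵐᵒᵖ) (j : N ⟶ X), (preadditiveCoyonedaObj T).essImage X ∧
      ∀ (X' : ModuleCat.{v} (End T)ᵐᵒᵖ) (f : N ⟶ X'), (preadditiveCoyonedaObj T).essImage X' →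
        ∃ g : X ⟶ X', j ≫ g = f := by
  obtain ⟨X, hX, h₀, h₁, p, hp, hfp⟩ := 𝒜.exists_angle_of_finite (T := T) N
  -- Both kernels are the image of `X.map 0`, so `N` is identified with the image of `X.map 1`.
  have hker : LinearMap.ker p = LinearMap.ker (postcomp T (X.map 1)) := by
    rw [hfp.linearMap_ker_eq, (hX.exact_postcomp hd T 0 (by omega)).linearMap_ker_eq]
  let e := rangeEquivOfKerEq p hp (postcomp T (X.map 1)) hker
  have he (t : T ⟶ X.obj 1) : (e (p t) : T ⟶ X.obj 2) = t ≫ X.map 1 := by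
    have : (p.quotKerEquivOfSurjective hp).symm (p t) = Submodule.Quotient.mk t := by
      rw [LinearEquiv.symm_apply_eq]
      rfl
    simp only [e, rangeEquivOfKerEq, LinearEquiv.trans_apply, this]
    rfl
  let j : N ⟶ (preadditiveCoyonedaObj T).obj (X.obj 2) :=
    ModuleCat.ofHom ((LinearMap.range (postcomp T (X.map 1))).subtype ∘ₗ e.toLinearMap)
  refine ⟨(hX.hasCoresolution_range hd (hom_sus_eq_zero hT.1 h₀) (d - 1) 1 (by omega)
    (by omega)).of_iso e.symm.toModuleIso, _, j, ⟨_, ⟨Iso.refl _⟩⟩, ?_⟩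
  rintro X' f ⟨Y, ⟨eY⟩⟩
  obtain ⟨u, hu⟩ := exists_map_eq_of_add h₁ ((f ≫ eY.inv).hom ∘ₗ p)
  have hu' (t : T ⟶ X.obj 1) : t ≫ u = (f ≫ eY.inv).hom (p t) := LinearMap.congr_fun hu t
  -- The lift `u` to the presentation kills the relations `X.map 0`, hence extends along `X.map 1`:
  -- this is the approximation property.
  obtain ⟨g, hg⟩ := hX.exists_map_comp_eq hd 0 (by omega) u
    (eq_zero_of_add h₀ _ fun t => by
      rw [← Category.assoc, hu', (hfp (t ≫ X.map 0)).2 ⟨t, rfl⟩]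
      exact map_zero (f ≫ eY.inv).hom)
  refine ⟨(preadditiveCoyonedaObj T).map g ≫ eY.hom, ?_⟩
  rw [← Category.assoc, ← Iso.eq_comp_inv]
  refine ModuleCat.hom_ext (LinearMap.ext fun x => ?_)
  obtain ⟨t, rfl⟩ := hp x
  rw [← hu', ← hg]
  change (e (p t) : T ⟶ X.obj 2) ≫ g = _
  rw [he, Category.assoc]

end Coresolutions

/-! ### Desuspended angles and the resolutions they give. -/

section Resolutions

variable {C : Type u} [Category.{v} C] [Preadditive C] [HasFiniteBiproducts C]
  {sus G : C ⥤ C} (adj : sus ⊣ G) [sus.IsEquivalence] [G.IsEquivalence] {d : ℕ}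

/-- The morphism `Σ⁻¹ X_{d+1} ⟶ X₀` of a sequence. -/
noncomputable def SuspSeq.connMap (X : SuspSeq sus d) : G.obj (X.obj (d + 1)) ⟶ X.obj 0 :=
  G.map X.conn ≫ inv (adj.unit.app _)

variable {𝒜 : Angulation sus d} (hd : 1 ≤ d)

omit [Preadditive C] [HasFiniteBiproducts C] [sus.IsEquivalence] [G.IsEquivalence] in
lemma exists_unit_comp_map_eq {Y W : C} (t : Y ⟶ G.obj W) :
    ∃ s : sus.obj Y ⟶ W, adj.unit.app Y ≫ G.map s = t := by
  obtain ⟨s, rfl⟩ := (adj.homEquiv Y W).surjective t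
  exact ⟨s, (adj.homEquiv_unit _ _ _).symm⟩

omit [sus.IsEquivalence] in
lemma eq_zero_of_unit_comp_map {Y W : C} (s : sus.obj Y ⟶ W)
    (h : adj.unit.app Y ≫ G.map s = 0) : s = 0 := by
  have := additive_of_isEquivalence G
  refine (adj.homEquiv Y W).injective ?_
  rw [adj.homEquiv_unit, adj.homEquiv_unit, h, G.map_zero, comp_zero]

variable {X : SuspSeq sus d} (hX : 𝒜.IsAngle X) (T : C)

include adj hd hX

lemma Angulation.IsAngle.exact_postcomp_inv (i : ℕ) (hi : i + 2 < d + 2) :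
    Function.Exact (postcomp T (G.map (X.map i))) (postcomp T (G.map (X.map (i + 1)))) := by
  have := additive_of_isEquivalence G
  intro t
  constructor
  · intro ht
    obtain ⟨s, rfl⟩ := exists_unit_comp_map_eq adj t
    rw [postcomp_apply, Category.assoc, ← G.map_comp] at ht
    obtain ⟨g, rfl⟩ := hX.exists_comp_map_eq hd i hi s (eq_zero_of_unit_comp_map adj _ ht)
    exact ⟨adj.unit.app T ≫ G.map g, by simp⟩
  · rintro ⟨s, rfl⟩
    rw [postcomp_apply, postcomp_apply, Category.assoc, ← G.map_comp, hX.map_comp_map hd i hi,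
      G.map_zero, comp_zero]

lemma Angulation.IsAngle.exact_map_connMap :
    Function.Exact (postcomp T (G.map (X.map d))) (postcomp T (X.connMap adj)) := by
  have := additive_of_isEquivalence G
  intro t
  constructor
  · intro ht
    obtain ⟨s, rfl⟩ := exists_unit_comp_map_eq adj t
    rw [postcomp_apply, SuspSeq.connMap, ← Category.assoc, IsIso.comp_inv_eq, zero_comp,
      Category.assoc, ← G.map_comp] at ht
    obtain ⟨g, rfl⟩ := hX.exists_comp_map_last_eq hd s (eq_zero_of_unit_comp_map adj _ ht)
    exact ⟨adj.unit.app T ≫ G.map g, by simp⟩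
  · rintro ⟨s, rfl⟩
    rw [postcomp_apply, postcomp_apply, Category.assoc, SuspSeq.connMap, ← G.map_comp_assoc,
      hX.map_comp_conn hd, G.map_zero, zero_comp, comp_zero]

omit T [G.IsEquivalence] in
lemma Angulation.IsAngle.exists_comp_connMap_eq {Y : C} (t : Y ⟶ X.obj 0) (ht : t ≫ X.map 0 = 0) :
    ∃ s : Y ⟶ G.obj (X.obj (d + 1)), s ≫ X.connMap adj = t := by
  obtain ⟨g, hg⟩ := hX.exists_comp_conn_eq hd t ht
  refine ⟨adj.unit.app Y ≫ G.map g, ?_⟩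
  rw [SuspSeq.connMap, Category.assoc, ← G.map_comp_assoc, hg, adj.unit_naturality_assoc,
    IsIso.hom_inv_id, Category.comp_id]

lemma Angulation.IsAngle.exact_connMap_map :
    Function.Exact (postcomp T (X.connMap adj)) (postcomp T (X.map 0)) := by
  have := additive_of_isEquivalence G
  intro t
  refine ⟨hX.exists_comp_connMap_eq adj hd t, ?_⟩
  rintro ⟨s, rfl⟩
  have h : X.connMap adj ≫ X.map 0 = 0 := by
    rw [SuspSeq.connMap, Category.assoc, ← cancel_mono (adj.unit.app (X.obj (0 + 1))), Category.assoc,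
      Category.assoc, ← adj.unit_naturality (X.map 0), IsIso.inv_hom_id_assoc, ← G.map_comp,
      hX.conn_comp_map hd, G.map_zero, zero_comp]
  rw [postcomp_apply, postcomp_apply, Category.assoc, h, comp_zero]

variable {T} (h₁ : ∀ f : sus.obj T ⟶ X.obj 1, f = 0)

include h₁

/-- The resolution starts at `G.obj (X.obj 2)`: the term before it gives `Hom(T, G X₁) ≅ Hom(Σ T,
X₁) = 0`, so the next map is injective. -/
lemma Angulation.IsAngle.hasResolution_range (n : ℕ) (hn : n + 2 + 1 < d + 2) :
    HasResolution (preadditiveCoyonedaObj T).essImage n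
      (ModuleCat.of (End T)ᵐᵒᵖ (LinearMap.range (postcomp T (G.map (X.map (n + 2)))))) := by
  have := additive_of_isEquivalence G
  induction n with
  | zero =>
    refine ⟨_, ⟨(LinearEquiv.ofInjective (postcomp T (G.map (X.map 2))) ?_).toModuleIso⟩⟩
    refine (injective_iff_map_eq_zero _).2 fun t ht => ?_
    obtain ⟨s, rfl⟩ := (hX.exact_postcomp_inv adj hd T 1 hn t).1 ht
    obtain ⟨s, rfl⟩ := exists_unit_comp_map_eq adj s
    rw [h₁ s, G.map_zero, comp_zero, map_zero]
  | succ n ih =>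
    exact hasResolution_succ_range _ _ (hX.exact_postcomp_inv adj hd T (n + 2) hn)
      ⟨_, ⟨Iso.refl _⟩⟩ (ih (by omega))

lemma Angulation.IsAngle.hasResolution_range_connMap :
    HasResolution (preadditiveCoyonedaObj T).essImage (d - 1)
      (ModuleCat.of (End T)ᵐᵒᵖ (LinearMap.range (postcomp T (X.connMap adj)))) := by
  have := additive_of_isEquivalence G
  have hE := hX.exact_map_connMap adj hd T
  obtain ⟨d, rfl⟩ := Nat.exists_eq_add_of_le' hd
  -- For `d = 1` the object after `X.obj 1` is already the last one, so `connMap` itself is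
  -- injective on `Hom(T, -)`.
  cases d with
  | zero =>
    refine ⟨_, ⟨(LinearEquiv.ofInjective (postcomp T (X.connMap adj)) ?_).toModuleIso⟩⟩
    refine (injective_iff_map_eq_zero _).2 fun t ht => ?_
    obtain ⟨s, rfl⟩ := (hE t).1 ht
    obtain ⟨s, rfl⟩ := exists_unit_comp_map_eq adj s
    have : s = 0 := h₁ s
    rw [this, G.map_zero, comp_zero, map_zero]
  | succ d =>
    exact hasResolution_succ_range _ _ hE ⟨_, ⟨Iso.refl _⟩⟩
      (hX.hasResolution_range adj hd h₁ d (by omega))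

end Resolutions

/-! ### Serre duality and embeddings into sums of copies of the dual of `End T`. -/

section Serre

variable {k : Type w} [Field k] {C : Type u} [Category.{v} C] [Preadditive C] [Linear k C]
  (hfin : ∀ X Y : C, Module.Finite k (X ⟶ Y)) (𝕊 : SerreFunctor k C) {T : C}

/-- The functional `γ ↦ b (m γ)` on `End T`. -/
def actionFunctional {M : Type*} [AddCommGroup M] [Module (End T)ᵐᵒᵖ M] [Module k M]
    [IsScalarTower k (End T)ᵐᵒᵖ M] (φ : Module.Dual k M) (m : M) : Module.Dual k (T ⟶ T) where
  toFun γ := φ (endOp γ • m)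
  map_add' a b := by rw [endOp_add, add_smul, map_add]
  map_smul' c a := by
    rw [show endOp (c • a) = c • endOp a from rfl, smul_assoc, map_smul, RingHom.id_apply]

include hfin in
/-- Each module embeds into a direct sum of copies of the dual of `End T`. -/
lemma exists_embedding_finsupp {M : Type*} [AddCommGroup M] [Module (End T)ᵐᵒᵖ M] [Module k M]
    [IsScalarTower k (End T)ᵐᵒᵖ M] {B : Type*} (b : Module.Basis B k M) :
    ∃ ι : M →ₗ[(End T)ᵐᵒᵖ] (B →₀ (T ⟶ 𝕊.S.obj T)), Function.Injective ι := by
  -- `End T` has a finite spanning set, and for each `γ` in it `m γ` has only finitely many nonzero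
  -- coordinates; hence a direct sum suffices, even for infinite `B`.
  have hs (m : M) : (Function.support
      fun j => 𝕊.iso T T (actionFunctional (b.coord j) m)).Finite := by
    obtain ⟨s, hs⟩ := (hfin T T).fg_top
    refine (s.finite_toSet.biUnion fun γ _ => (b.repr (endOp γ • m)).support.finite_toSet).subset
      fun j hj => ?_
    by_contra hj'
    refine hj ?_
    have : actionFunctional (b.coord j) m = 0 := LinearMap.ext_on hs fun γ hγ => by
      by_contra h
      exact hj' (Set.mem_biUnion hγ (Finsupp.mem_support_iff.2 h))
    simp [this]
  refine ⟨{ toFun m := Finsupp.ofSupportFinite _ (hs m), map_add' := ?_, map_smul' := ?_ }, ?_⟩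
  · intro x y
    ext j
    change 𝕊.iso T T _ = 𝕊.iso T T _ + 𝕊.iso T T _
    rw [← map_add]
    congr 1
    refine LinearMap.ext fun γ => ?_
    simp [actionFunctional]
  · intro c x
    obtain ⟨c, rfl⟩ := endOp_surjective c
    ext j
    change 𝕊.iso T T _ = c ≫ 𝕊.iso T T _
    rw [← 𝕊.naturality_right]
    congr 1
    refine LinearMap.ext fun γ => ?_
    change b.coord j (endOp γ • endOp c • x) = b.coord j (endOp (γ ≫ c) • x)
    rw [endOp_comp, mul_smul]
  · refine (injective_iff_map_eq_zero _).2 fun m hm => b.repr.injective (Finsupp.ext fun j => ?_)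
    have h : 𝕊.iso T T (actionFunctional (b.coord j) m) = 0 := DFunLike.congr_fun hm j
    -- Evaluating the functional at the identity recovers the `j`-th coordinate of `m`.
    have := LinearMap.congr_fun ((𝕊.iso T T).map_eq_zero_iff.1 h) (𝟙 T)
    simpa [actionFunctional, endOp_id] using this

include 𝕊 in
-- With `X = T` and `Y = Σ T` this turns rigidity of `T` into `Hom(Σ T, S T) = 0`.
lemma SerreFunctor.hom_eq_zero {X Y : C} (h : ∀ f : X ⟶ Y, f = 0) (f : Y ⟶ 𝕊.S.obj X) :
    f = 0 := by
  obtain ⟨φ, rfl⟩ := (𝕊.iso X Y).surjective f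
  rw [show φ = 0 from LinearMap.ext fun g => by rw [h g, map_zero, map_zero], map_zero]

/-- The vector space structure on a module over `(End T)ᵐᵒᵖ`. -/
abbrev linearStructure (k : Type w) [Field k] [Linear k C] (M : Type*) [AddCommGroup M]
    [Module (End T)ᵐᵒᵖ M] : Module k M :=
  Module.compHom M (algebraMap k (End T)ᵐᵒᵖ)

lemma isScalarTower_linearStructure (M : Type*) [AddCommGroup M] [Module (End T)ᵐᵒᵖ M] :
    letI := linearStructure (T := T) k M
    IsScalarTower k (End T)ᵐᵒᵖ M :=
  letI := linearStructure (T := T) k M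
  ⟨fun r a m => by
    rw [Algebra.smul_def, mul_smul]
    rfl⟩

variable [HasFiniteBiproducts C]

include hfin in
lemma exists_embedding_biproduct (M : Type v) [AddCommGroup M] [Module (End T)ᵐᵒᵖ M]
    [Module.Finite (End T)ᵐᵒᵖ M] : ∃ (n : ℕ)
    (ι : M →ₗ[(End T)ᵐᵒᵖ] (T ⟶ ⨁ fun _ : Fin n => 𝕊.S.obj T)), Function.Injective ι := by
  let _ := linearStructure (T := T) k M
  have := isScalarTower_linearStructure (k := k) (T := T) M
  have : Module.Finite k (End T) := hfin T T
  have : Module.Finite k M := Module.Finite.trans (End T)ᵐᵒᵖ M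
  obtain ⟨ι, hι⟩ := exists_embedding_finsupp (T := T) hfin 𝕊 (Module.finBasis k M)
  refine ⟨Module.finrank k M,
    { toFun m := biproduct.lift (fun j => ι m j), map_add' := ?_, map_smul' := ?_ },
    fun x y h => hι (Finsupp.ext fun j => ?_)⟩
  · intro x y
    refine biproduct.hom_ext _ _ fun j => ?_
    simp
  · intro c x
    obtain ⟨c, rfl⟩ := endOp_surjective c
    refine biproduct.hom_ext _ _ fun j => ?_
    simp [endOp_smul]
  · have := congrArg (fun z => z ≫ biproduct.π (fun _ : Fin _ => 𝕊.S.obj T) j) h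
    simpa using this

end Serre

/-! ### The cluster tilting subcategory, its additive generator, and the global dimension. -/

section ClusterTilting

variable {k : Type w} [Field k] {C : Type u} [Category.{v} C] [Preadditive C]
  [HasFiniteBiproducts C] [Linear k C] (hfin : ∀ X Y : C, Module.Finite k (X ⟶ Y))
  {sus : C ⥤ C} {d : ℕ} {𝒜 : Angulation sus d} (hd : 1 ≤ d) [sus.IsEquivalence]
  (𝕊 : SerreFunctor k C) {T : C} (hT : IsOTClusterTilting 𝒜 T)

include hfin

omit [HasFiniteBiproducts C] in
lemma isNoetherianRing_endOp (T : C) : IsNoetherianRing (End T)ᵐᵒᵖ :=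
  have : Module.Finite k (End T) := hfin T T
  IsNoetherianRing.of_finite k _

omit [HasFiniteBiproducts C] in
lemma finite_hom (T X : C) : Module.Finite (End T)ᵐᵒᵖ (T ⟶ X) :=
  have := hfin T X
  have : IsScalarTower k (End T)ᵐᵒᵖ (T ⟶ X) := ⟨fun r a t => Linear.smul_comp _ _ _ r a.unop t⟩
  Module.Finite.of_restrictScalars_finite k _ _

omit [HasFiniteBiproducts C] in
lemma fgRightModules_of_essImage {M : ModuleCat.{v} (End T)ᵐᵒᵖ}
    (hM : (preadditiveCoyonedaObj T).essImage M) : fgRightModules (End T) M := by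
  obtain ⟨X, ⟨e⟩⟩ := hM
  have : Module.Finite (End T)ᵐᵒᵖ ((preadditiveCoyonedaObj T).obj X) := finite_hom hfin T X
  exact Module.Finite.equiv e.toLinearEquiv

include hd hT

include 𝕊 in
-- Embed `N`, then the cokernel, into `Hom(T, -)` of sums of copies of `S T`. Fullness realizes the
-- composite by a morphism, which is completed to an angle.
lemma IsOTClusterTilting.exists_copresentation (N : Type v) [AddCommGroup N]
    [Module (End T)ᵐᵒᵖ N] [Module.Finite (End T)ᵐᵒᵖ N] : ∃ X : SuspSeq sus d, 𝒜.IsAngle X ∧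
      (∀ f : sus.obj T ⟶ X.obj 1, f = 0) ∧ ∃ ι : N →ₗ[(End T)ᵐᵒᵖ] (T ⟶ X.obj 0),
      Function.Injective ι ∧ Function.Exact ι (postcomp T (X.map 0)) := by
  obtain ⟨n, ι, hι⟩ := exists_embedding_biproduct (T := T) hfin 𝕊 N
  have := finite_hom hfin T (⨁ fun _ : Fin n => 𝕊.S.obj T)
  obtain ⟨m, κ, hκ⟩ := exists_embedding_biproduct (T := T) hfin 𝕊 (_ ⧸ LinearMap.range ι)
  obtain ⟨g, hg⟩ := hT.exists_postcomp_eq hd (κ ∘ₗ (LinearMap.range ι).mkQ)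
  obtain ⟨X, hX, e₀, e₁, h⟩ := 𝒜.complete g
  refine ⟨X, hX, fun f => ?_, postcomp T e₀.inv ∘ₗ ι, fun x y hxy => hι ?_, fun t => ?_⟩
  · rw [← cancel_mono e₁.hom]
    refine biproduct.hom_ext _ _ fun j => ?_
    rw [𝕊.hom_eq_zero hT.1 ((f ≫ e₁.hom) ≫ biproduct.π _ j), zero_comp, zero_comp]
  · exact (cancel_mono e₀.inv).1 hxy
  · have h₁ : t ≫ X.map 0 = 0 ↔ κ ((LinearMap.range ι).mkQ (t ≫ e₀.hom)) = 0 := by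
      rw [← cancel_mono e₁.hom, zero_comp, Category.assoc, h, ← Category.assoc]
      exact Eq.congr_left (LinearMap.congr_fun hg (t ≫ e₀.hom))
    rw [postcomp_apply, h₁, map_eq_zero_iff κ hκ, Submodule.mkQ_apply,
      Submodule.Quotient.mk_eq_zero]
    constructor
    · rintro ⟨x, hx⟩
      exact ⟨x, by simp [hx]⟩
    · rintro ⟨x, rfl⟩
      exact ⟨x, by simp⟩

include 𝕊 in
lemma IsOTClusterTilting.exists_right_approximation (N : ModuleCat.{v} (End T)ᵐᵒᵖ)
    [Module.Finite (End T)ᵐᵒᵖ N] :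
    HasResolution (preadditiveCoyonedaObj T).essImage (d - 1) N ∧
    ∃ (X : ModuleCat.{v} (End T)ᵐᵒᵖ) (p : X ⟶ N), (preadditiveCoyonedaObj T).essImage X ∧
      ∀ (X' : ModuleCat.{v} (End T)ᵐᵒᵖ) (f : X' ⟶ N), (preadditiveCoyonedaObj T).essImage X' →
        ∃ g : X' ⟶ X, g ≫ p = f := by
  obtain ⟨X, hX, h₁, ι, hι, hE⟩ := hT.exists_copresentation hfin hd 𝕊 N
  let adj : sus ⊣ sus.inv := sus.asEquivalence.toAdjunction
  have hr : LinearMap.range ι = LinearMap.range (postcomp T (X.connMap adj)) := by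
    rw [← hE.linearMap_ker_eq, ← (hX.exact_connMap_map adj hd T).linearMap_ker_eq]
  let e : N ≃ₗ[(End T)ᵐᵒᵖ] LinearMap.range (postcomp T (X.connMap adj)) :=
    (LinearEquiv.ofInjective ι hι).trans (LinearEquiv.ofEq _ _ hr)
  let p : (preadditiveCoyonedaObj T).obj (sus.inv.obj (X.obj (d + 1))) ⟶ N :=
    ModuleCat.ofHom (e.symm.toLinearMap ∘ₗ (postcomp T (X.connMap adj)).rangeRestrict)
  have hp (t : T ⟶ sus.inv.obj (X.obj (d + 1))) : ι (p.hom t) = t ≫ X.connMap adj := by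
    change ((e (e.symm _) : LinearMap.range _) : T ⟶ X.obj 0) = _
    rw [e.apply_symm_apply]
    rfl
  refine ⟨(hX.hasResolution_range_connMap adj hd h₁).of_iso e.symm.toModuleIso, _, p,
    ⟨_, ⟨Iso.refl _⟩⟩, ?_⟩
  rintro X' f ⟨Y, ⟨eY⟩⟩
  obtain ⟨u, hu⟩ := hT.exists_postcomp_eq hd (ι ∘ₗ (eY.hom ≫ f).hom)
  have hu' (t : T ⟶ Y) : t ≫ u = ι ((eY.hom ≫ f).hom t) := LinearMap.congr_fun hu t
  -- `u ≫ X.map 0` is killed by all maps from `T`, and its target receives no nonzero map from `Σ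
  -- T`, so `eq_zero` applies and `u` lifts along `connMap`.
  obtain ⟨g, hg⟩ := hX.exists_comp_connMap_eq adj hd u
    (hT.eq_zero hd h₁ _ fun t => by
      rw [← Category.assoc, hu']
      exact (hE _).2 ⟨_, rfl⟩)
  refine ⟨eY.inv ≫ (preadditiveCoyonedaObj T).map g, ?_⟩
  rw [Category.assoc, Iso.inv_comp_eq]
  refine ModuleCat.hom_ext (LinearMap.ext fun t => hι ?_)
  change T ⟶ Y at t
  refine (hp (t ≫ g)).trans ((?_ : _ = t ≫ u).trans (hu' t))
  rw [Category.assoc, hg]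

variable [IsIdempotentComplete C]

include 𝕊 in
/-- The modules `Hom(T, X)` form a `d`-cluster tilting subcategory. -/
lemma IsOTClusterTilting.isClusterTiltingSubcategory :
    IsClusterTiltingSubcategory d (preadditiveCoyonedaObj T).essImage := by
  have := isNoetherianRing_endOp hfin T
  refine ⟨⟨fun M => ⟨fun hM => ⟨fgRightModules_of_essImage hfin hM,
    fun N hN i hi hid => hT.subsingleton_ext hd hM hN i hi hid⟩, ?_⟩,
    fun M => ⟨fun hM => ⟨fgRightModules_of_essImage hfin hM,
    fun N hN i hi hid => hT.subsingleton_ext hd hN hM i hi hid⟩, ?_⟩⟩, fun M hM => ?_⟩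
  · rintro ⟨hM, h⟩
    have : Module.Finite (End T)ᵐᵒᵖ M := hM
    obtain ⟨D, hD, ⟨r⟩⟩ := (hT.exists_right_approximation hfin hd 𝕊 M).1.exists_retract h
    exact hT.essImage_of_retract hd k hfin hD r
  · rintro ⟨hM, h⟩
    have : Module.Finite (End T)ᵐᵒᵖ M := hM
    obtain ⟨D, hD, ⟨r⟩⟩ := (hT.exists_left_approximation hd M).1.exists_retract h
    exact hT.essImage_of_retract hd k hfin hD r
  · have : Module.Finite (End T)ᵐᵒᵖ M := hM
    exact ⟨(hT.exists_right_approximation hfin hd 𝕊 M).2, (hT.exists_left_approximation hd M).2⟩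

omit hd [sus.IsEquivalence] hT [IsIdempotentComplete C] in
-- Only the existence of decompositions is needed. If `X ≅ Y ⊞ Z` with both summands nonzero, block
-- diagonal maps embed `End Y × End Z` in `End X`, so induction on `dim End X` applies to `Y` and
-- `Z`.
lemma exists_additiveGenerator (hind : HasFinitelyManyIndecomposables C) :
    ∃ M : C, ∀ X : C, add M X := by
  have := hasBinaryBiproducts_of_finite_biproducts C
  obtain ⟨s, hs, h⟩ := hind
  have := hs.to_subtype
  refine ⟨⨁ fun Y : s => (Y : C), fun X => ?_⟩
  induction hn : Module.finrank k (X ⟶ X) using Nat.strong_induction_on generalizing X with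
  | _ n ih =>
  by_cases hX : IsZero X
  · exact add_iff.2 ⟨0, Fin.elim0, Fin.elim0, hX.eq_of_src _ _⟩
  by_cases hXi : Indecomposable X
  · obtain ⟨Y, hY, ⟨e⟩⟩ := h X hXi
    refine add_iff.2 ⟨1, fun _ => e.hom ≫ biproduct.ι (fun Y : s => (Y : C)) ⟨Y, hY⟩,
      fun _ => biproduct.π (fun Y : s => (Y : C)) ⟨Y, hY⟩ ≫ e.inv, ?_⟩
    simp
  · simp only [Indecomposable, not_and, not_forall, not_or] at hXi
    obtain ⟨Y, Z, e, hY, hZ⟩ := hXi hX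
    have hpos {W : C} (hW : ¬ IsZero W) : 0 < Module.finrank k (W ⟶ W) := by
      have := hfin W W
      have : Nontrivial (W ⟶ W) := ⟨𝟙 W, 0, fun h => hW ((IsZero.iff_id_eq_zero W).2 h)⟩
      exact Module.finrank_pos
    have hle : Module.finrank k (Y ⟶ Y) + Module.finrank k (Z ⟶ Z) ≤ n := by
      have := hfin X X
      have := hfin Y Y
      have := hfin Z Z
      let φ : ((Y ⟶ Y) × (Z ⟶ Z)) →ₗ[k] (X ⟶ X) :=
        { toFun p := e.hom ≫ biprod.map p.1 p.2 ≫ e.inv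
          map_add' p q := by
            rw [← Preadditive.comp_add, ← Preadditive.add_comp]
            congr 2
            ext <;> simp
          map_smul' c p := by
            rw [RingHom.id_apply, ← Linear.comp_smul, ← Linear.smul_comp]
            congr 2
            ext <;> simp }
      have hφ : Function.Injective φ := by
        intro p q hpq
        have : biprod.map p.1 p.2 = biprod.map q.1 q.2 :=
          (cancel_mono e.inv).1 ((cancel_epi e.hom).1 hpq)
        refine Prod.ext ?_ ?_
        · simpa using congrArg (fun z => biprod.inl ≫ z ≫ biprod.fst) this
        · simpa using congrArg (fun z => biprod.inr ≫ z ≫ biprod.snd) this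
      rw [← Module.finrank_prod, ← hn]
      exact LinearMap.finrank_le_finrank_of_injective hφ
    have hY' := hpos hY
    have hZ' := hpos hZ
    obtain ⟨p, a, b, hab⟩ := add_iff.1 (ih _ (by omega) Y rfl)
    obtain ⟨q, a', b', hab'⟩ := add_iff.1 (ih _ (by omega) Z rfl)
    refine add_iff.2 ⟨p + q,
      Fin.append (fun j => e.hom ≫ biprod.fst ≫ a j) (fun j => e.hom ≫ biprod.snd ≫ a' j),
      Fin.append (fun j => b j ≫ biprod.inl ≫ e.inv) (fun j => b' j ≫ biprod.inr ≫ e.inv), ?_⟩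
    rw [Fin.sum_univ_add]
    simp only [Fin.append_left, Fin.append_right, Category.assoc]
    have h₁ := congrArg (fun z => e.hom ≫ biprod.fst ≫ z ≫ biprod.inl ≫ e.inv) hab
    have h₂ := congrArg (fun z => e.hom ≫ biprod.snd ≫ z ≫ biprod.inr ≫ e.inv) hab'
    simp only [Preadditive.sum_comp, Preadditive.comp_sum, Category.assoc,
      Category.id_comp] at h₁ h₂
    rw [h₁, h₂]
    have := congrArg (fun z => e.hom ≫ z ≫ e.inv) (biprod.total (X := Y) (Y := Z))
    simpa only [Preadditive.add_comp, Preadditive.comp_add, Category.assoc, Category.id_comp,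
      Iso.hom_inv_id] using this

omit hd [sus.IsEquivalence] hT [IsIdempotentComplete C] hfin [Linear k C] in
lemma add_map {D : Type*} [Category D] [Preadditive D] [HasFiniteBiproducts D] (H : C ⥤ D)
    [H.Additive] {M X : C} (h : add M X) : add (H.obj M) (H.obj X) := by
  obtain ⟨n, a, b, hab⟩ := add_iff.1 h
  refine add_iff.2 ⟨n, fun j => H.map (a j), fun j => H.map (b j), ?_⟩
  simp only [← H.map_comp, ← H.map_sum, hab, H.map_id]

omit hd [sus.IsEquivalence] hT [IsIdempotentComplete C] hfin [Linear k C] in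
lemma exists_retract_of_add_map {D : Type*} [Category D] [Preadditive D] [HasFiniteBiproducts D]
    (H : C ⥤ D) [H.Additive] {M : C} {N : D} (h : add (H.obj M) N) :
    ∃ X : C, Nonempty (Retract N (H.obj X)) := by
  obtain ⟨n, a, b, hab⟩ := add_iff.1 h
  refine ⟨⨁ fun _ : Fin n => M, ⟨⟨∑ j, a j ≫ H.map (biproduct.ι (fun _ : Fin n => M) j),
    ∑ j, H.map (biproduct.π (fun _ : Fin n => M) j) ≫ b j, ?_⟩⟩⟩
  rw [Preadditive.sum_comp, ← hab]
  refine Finset.sum_congr rfl fun i _ => ?_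
  rw [Preadditive.comp_sum, Finset.sum_eq_single i]
  · rw [Category.assoc, ← H.map_comp_assoc, biproduct.ι_π_self, H.map_id, Category.id_comp]
  · intro j _ hj
    rw [Category.assoc, ← H.map_comp_assoc, biproduct.ι_π_ne _ hj.symm, H.map_zero, zero_comp,
      comp_zero]
  · exact fun h => absurd (Finset.mem_univ i) h

include 𝕊 in
lemma IsOTClusterTilting.isWeaklyRepFinite (hind : HasFinitelyManyIndecomposables C) :
    IsWeaklyRepFinite (End T) d := by
  obtain ⟨M, hM⟩ := exists_additiveGenerator hfin hind
  have h : add ((preadditiveCoyonedaObj T).obj M) = (preadditiveCoyonedaObj T).essImage := by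
    ext N
    constructor
    · intro hN
      obtain ⟨X, ⟨r⟩⟩ := exists_retract_of_add_map _ hN
      exact hT.essImage_of_retract hd k hfin ⟨X, ⟨Iso.refl _⟩⟩ r
    · rintro ⟨X, ⟨e⟩⟩
      exact add_of_iso e (add_map _ (hM X))
  refine ⟨(preadditiveCoyonedaObj T).obj M,
    fgRightModules_of_essImage hfin ⟨M, ⟨Iso.refl _⟩⟩, ?_⟩
  rw [h]
  exact hT.isClusterTiltingSubcategory hfin hd 𝕊

omit [IsIdempotentComplete C]

include 𝕊 in
-- Embed `M` in a direct sum `I` of copies of `Hom(T, S T)`. As `pd I ≤ d ≤ n` and the cokernel has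
-- projective dimension at most `n + 1`, the long exact sequence gives `pd M ≤ n`.
lemma IsOTClusterTilting.globalDimensionLE_of_succ {n : ℕ} (hn : d ≤ n)
    (h : GlobalDimensionLE (End T) (n + 1)) : GlobalDimensionLE (End T) n := fun M => by
  let _ := linearStructure (T := T) k M
  have := isScalarTower_linearStructure (k := k) (T := T) M
  obtain ⟨ι, hι⟩ := exists_embedding_finsupp (T := T) hfin 𝕊 (Module.Basis.ofVectorSpace k M)
  have hE : Function.Exact ι (LinearMap.range ι).mkQ := LinearMap.exact_iff.2 (by simp)
  have h₂ : HasProjectiveDimensionLT (rangeComplex _ _ hE).X₂ (d + 1) :=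
    hT.hasUniformProjDimLE hd (𝕊.hom_eq_zero hT.1) (Module.Basis.ofVectorSpaceIndex k M)
  have h₁ : HasProjectiveDimensionLT (ModuleCat.of (End T)ᵐᵒᵖ (LinearMap.range ι)) (n + 1) :=
    (rangeComplex_shortExact _ _ hE).hasProjectiveDimensionLT_X₁ (n + 1)
      (hasProjectiveDimensionLT_of_ge _ (d + 1) (n + 1) (by omega)) (h _)
  exact hasProjectiveDimensionLT_of_iso (LinearEquiv.ofInjective ι hι).toModuleIso.symm (n + 1)

include 𝕊 in
lemma IsOTClusterTilting.globalDimensionLE {n : ℕ} (h : GlobalDimensionLE (End T) n) :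
    GlobalDimensionLE (End T) d := by
  obtain hn | hn := le_total n d
  · exact fun M => have := h M; hasProjectiveDimensionLT_of_ge _ (n + 1) _ (by omega)
  · induction n, hn using Nat.le_induction with
    | base => exact h
    | succ n hn ih => exact ih (hT.globalDimensionLE_of_succ hfin hd 𝕊 hn h)

end ClusterTilting

end HigherCluster

theorem corollary0p6 {k : Type w} [Field k] [IsAlgClosed k] (d : ℕ) (hd : 1 ≤ d)
    {C : Type u} [Category.{v} C] [Preadditive C] [HasFiniteBiproducts C] [Linear k C]
    (hfin : ∀ X Y : C, Module.Finite k (X ⟶ Y)) [IsIdempotentComplete C]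
    (sus : C ⥤ C) [sus.IsEquivalence] (𝒜 : HigherCluster.Angulation sus d)
    (hSerre : Nonempty (HigherCluster.SerreFunctor k C))
    (T : C) (hT : HigherCluster.IsOTClusterTilting 𝒜 T)
    (hind : HigherCluster.HasFinitelyManyIndecomposables C) :
    HigherCluster.IsWeaklyRepFinite (End T) d ∧
    ((∃ n : ℕ, HigherCluster.GlobalDimensionLE (End T) n) →
      HigherCluster.IsRepFinite (End T) d) := by
  obtain ⟨𝕊⟩ := hSerre
  have h := hT.isWeaklyRepFinite hfin hd 𝕊 hind
  exact ⟨h, fun ⟨_, hn⟩ => ⟨h, hT.globalDimensionLE hfin hd 𝕊 hn⟩⟩
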